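/- Let $G$ be a finitely generated group which is not virtually cyclic, let $S$ be a finite generating set, and let $d$ be the word metric on $G$, i.e. the graph distance on the vertices of $\mathrm{Cay}(G,S)$. Geodesics are understood as (finite or infinite) geodesics in $(G,d)$, i.e. isometrically embedded intervals of $\mathbb{Z}$; $\mathcal N_R(A)$ denotes the $R$-neighbourhood of $A\subset G$; and for $A,Y\subset G$, $\pi_A(Y)$ denotes the set of all points $a \in A$ with $d(y,a)=d(y,A)$ for some $y\in Y$. A geodesic $\gamma$ is \emph{$D$-contracting} ($D>0$) if $\operatorname{diam}(\pi_\gamma(\kappa))<D$ for every geodesic $\kappa$ with $d(\gamma,\kappa)>D$. An element $f\in G$ is \emph{contracting} if it has a contracting axis, that is, an infinite geodesic $\gamma$ which is $D$-contracting for some $D>0$ and lies at bounded Hausdorff distance from the orbit $\{f^i\}_{i\in\mathbb Z}$. A contracting element $f$ with contracting axis $\gamma$ is \emph{strongly independent} of a subset $H\subset G$ if $\sup_{t\in G}\operatorname{diam}(\pi_\gamma(tH))<\infty$. A subset $H\subset G$ is \emph{coarsely geodesically connected} if there is $R>0$ such that any $x,y\in H$ are joined by some geodesic contained in $\mathcal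 N_R(H)$. For $K>0$, the \emph{$K$-coarse excursion} of $g\in G$ into $H$ is $$\mathcal E_{H,K}(g):=\max_{\gamma}\,\max_{t\in G}\operatorname{diam}\bigl(\gamma\cap\mathcal N_K(tH)\bigr),$$ where $\gamma$ ranges over all geodesics from the identity to $g$. Let $\mathbb P_n$ be the uniform probability measure on the ball $B(n)=\{g\in G: d(e,g)\le n\}$. Let $H\subset G$ be a coarsely geodesically connected subset of infinite diameter, and suppose that $G$ has a contracting element which is strongly independent of $H$. Then there exists $K>0$ such that for every $p>0$ there exist constants $C_1>0$ and $C_2$ such that $$\mathbb P_n\bigl(g: C_1\log n\le \mathcal E_{H,K}(g)\le C_2\log n\bigr)\ \ge\ 1-O(n^{-p})\qquad (n\ge 1),$$ where the implied constant does not depend on $n$. -/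

import Mathlib

open scoped ENNReal Pointwise

namespace CoarseExcursion

variable {G : Type*} [Group G]

/-- `G` is virtually cyclic: it has a cyclic subgroup of finite index. -/
def IsVirtuallyCyclic (G : Type*) [Group G] : Prop :=
  ∃ C : Subgroup G, IsCyclic C ∧ C.FiniteIndex

/-- The word metric on `G`: the graph distance between vertices of the Cayley graph of `(G, S)`. -/
noncomputable def wordDist (S : Set G) (x y : G) : ℕ :=
  (SimpleGraph.mulCayley S).dist x y

/-- The ball of radius `n` around the identity. -/
def ball (S : Set G) (n : ℕ) : Set G :=
  {g | wordDist S 1 g ≤ n}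

/-- The uniform probability on the ball of radius `n`, evaluated at the set `E`. -/
noncomputable def ballProb (S : Set G) (n : ℕ) (E : Set G) : ℝ :=
  ((ball S n ∩ E).ncard : ℝ) / ((ball S n).ncard : ℝ)

/-- The diameter of a subset, possibly infinite (and `0` for the empty set). -/
noncomputable def diam (S : Set G) (A : Set G) : ℝ≥0∞ :=
  ⨆ x ∈ A, ⨆ y ∈ A, (wordDist S x y : ℝ≥0∞)

/-- The (infimal) distance between two subsets. -/
noncomputable def setDist (S : Set G) (A B : Set G) : ℝ≥0∞ :=
  ⨅ x ∈ A, ⨅ y ∈ B, (wordDist S x y : ℝ≥0∞)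

/-- The `R`-neighbourhood of a subset. -/
def nbhd (S : Set G) (R : ℝ) (A : Set G) : Set G :=
  {x | ∃ a ∈ A, (wordDist S x a : ℝ) ≤ R}

/-- `c` restricted to the interval `I` of integers is a geodesic parametrized by arc length. -/
def IsGeodesicParam (S : Set G) (I : Set ℤ) (c : ℤ → G) : Prop :=
  I.Nonempty ∧ I.OrdConnected ∧ ∀ i ∈ I, ∀ j ∈ I, (wordDist S (c i) (c j) : ℤ) = |i - j|

/-- `γ` is the set of vertices of a geodesic (a segment, a ray or a line). -/
def IsGeodesic (S : Set G) (γ : Set G) : Prop :=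
  ∃ (I : Set ℤ) (c : ℤ → G), IsGeodesicParam S I c ∧ γ = c '' I

/-- `γ` is the set of vertices of a geodesic segment from `x` to `y`. -/
def IsGeodesicFromTo (S : Set G) (x y : G) (γ : Set G) : Prop :=
  ∃ (n : ℕ) (c : ℤ → G), IsGeodesicParam S (Set.Icc 0 (n : ℤ)) c ∧
    c 0 = x ∧ c n = y ∧ γ = c '' Set.Icc 0 (n : ℤ)

/-- The nearest-point projection of the set `Y` to the set `A`: all points of `A` that are nearest
to some point of `Y`. -/
def proj (S : Set G) (A Y : Set G) : Set G :=
  {a | a ∈ A ∧ ∃ y ∈ Y, ∀ b ∈ A, wordDist S y a ≤ wordDist S y b}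

/-- `γ` is `D`-contracting: every geodesic at distance more than `D` from `γ` has a projection
to `γ` of diameter less than `D`. -/
def IsContractingSet (S : Set G) (D : ℝ) (γ : Set G) : Prop :=
  ∀ κ : Set G, IsGeodesic S κ → ENNReal.ofReal D < setDist S γ κ →
    diam S (proj S γ κ) < ENNReal.ofReal D

/-- `γ` is an axis of `g`: an infinite geodesic at bounded Hausdorff distance from the orbit
`{g ^ i : i ∈ ℤ}`. -/
def IsAxis (S : Set G) (g : G) (γ : Set G) : Prop :=
  IsGeodesic S γ ∧ γ.Infinite ∧
    ∃ A : ℝ, γ ⊆ nbhd S A (Set.range fun i : ℤ => g ^ i) ∧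
      (Set.range fun i : ℤ => g ^ i) ⊆ nbhd S A γ

/-- `f` is a contracting element which is strongly independent of `H`: it has a contracting axis
to which all the translates of `H` have projections of uniformly bounded diameter. -/
def IsContractingStronglyIndependent (S : Set G) (f : G) (H : Set G) : Prop :=
  ∃ γ : Set G, IsAxis S f γ ∧ (∃ D : ℝ, 0 < D ∧ IsContractingSet S D γ) ∧
    (⨆ t : G, diam S (proj S γ (t • H))) < ⊤

/-- `H` is coarsely geodesically connected. -/
def IsCoarselyGeodesicallyConnected (S : Set G) (H : Set G) : Prop :=
  ∃ R : ℝ, 0 < R ∧ ∀ x ∈ H, ∀ y ∈ H, ∃ γ : Set G, IsGeodesicFromTo S x y γ ∧ γ ⊆ nbhd S R H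

/-- The `K`-coarse excursion of the geodesic `γ` into `H`. -/
noncomputable def geodesicExcursion (S : Set G) (H : Set G) (K : ℝ) (γ : Set G) : ℝ≥0∞ :=
  ⨆ t : G, diam S (γ ∩ nbhd S K (t • H))

/-- The `K`-coarse excursion of the element `g` into `H`: the maximum of the excursions of all
geodesics from the identity to `g`. -/
noncomputable def excursion (S : Set G) (H : Set G) (K : ℝ) (g : G) : ℝ≥0∞ :=
  ⨆ (γ : Set G) (_ : IsGeodesicFromTo S 1 g γ), geodesicExcursion S H K γ

end CoarseExcursion

namespace CoarseExcursion

/-! ### Geodesics and contracting sets for integer-valued distances -/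

section

variable {G : Type*}

/-! A contracting element `f` makes it possible to concatenate group elements with control. Since
`G` is not virtually cyclic, some element is transverse to the cyclic group of `f`, and any `g`, `h`
can be joined by a bridge around a fixed long power of `f` so that every geodesic from `1` to the
result passes near `g` and near the beginning of `h` (`IsExtender.pass`). Hence `g` is determined up
to bounded ambiguity by the result and the length of `g`. This yields `|B(i)| |B(j)| ≤ C |B(i + j)|`
(`IsExtender.ncard_bset_mul_le`), which allows estimates on pieces of a geodesic to be multiplied.

The key count is `IsExtender.ncard_avoiding_le`. Let `q = |B(1)|`. Elements of length `m` with a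
geodesic that fellow-travels no translate of `[1, b]` number at most a constant times `(|b| + 1) q ^
|b| |B(m)| / (m + 1)`. Indeed `b` can be inserted at each of `m + 1` places. If two insertions at
distant places gave the same element, the geodesic with the later insertion would already contain a
copy of `b` (`IsExtender.exists_passage`).

Lower bound on the excursion: take for `b` a segment near `H` of length about `C₁ log n`, with `C₁`
so small that the exponential factor is about the square root of `n`. Cutting off `k` pieces of
length about `n / (2k)`, all of which must avoid `b`, gives probability `O(n ^ (-k/2))`, and `k` is
chosen according to `p`.

Upper bound: by strong independence, a geodesic between points near one translate of `H` avoids a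
fixed power of `f` (`exists_avoiding_of_independent`). Avoiding a fixed element is exponentially
rare in the length, so a large `C₂` beats the factor `n + 1` from the possible positions of a
segment of length `C₂ log n`. -/

/-- `c` restricted to `{0, …, n}` is a geodesic for `d`, parametrized by arc length. -/
def IsGeod (d : G → G → ℕ) (n : ℕ) (c : ℕ → G) : Prop :=
  ∀ i j, i ≤ j → j ≤ n → d (c i) (c j) + i = j

/-- `p` is a point of `P` nearest to `y`. -/
def Nearest (d : G → G → ℕ) (P : Set G) (y p : G) : Prop :=
  p ∈ P ∧ ∀ b ∈ P, d y p ≤ d y b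

/-- Geodesics whose endpoints project to `P` more than `E` apart pass, in order, `E`-close to these
projections. -/
def Contr (d : G → G → ℕ) (E : ℕ) (P : Set G) : Prop :=
  ∀ n c, IsGeod d n c → ∀ p q, Nearest d P (c 0) p → Nearest d P (c n) q → E < d p q →
    ∃ i j, i ≤ j ∧ j ≤ n ∧ d (c i) p ≤ E ∧ d (c j) q ≤ E

variable {d : G → G → ℕ}

lemma IsGeod.sub {n : ℕ} {c : ℕ → G} (hc : IsGeod d n c) (k m : ℕ) (h : k + m ≤ n) :
    IsGeod d m (fun i => c (k + i)) := by
  intro i j hij hj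
  have := hc (k + i) (k + j) (by omega) (by omega)
  simp only
  omega

lemma IsGeod.dist_zero {n : ℕ} {c : ℕ → G} (hc : IsGeod d n c) {i : ℕ} (h : i ≤ n) :
    d (c 0) (c i) = i := by
  have := hc 0 i (by omega) h
  omega

lemma exists_nearest (d : G → G → ℕ) {P : Set G} (hP : P.Nonempty) (y : G) :
    ∃ p, Nearest d P y p := by
  classical
  have h : ∃ n, ∃ p ∈ P, d y p = n := let ⟨p, hp⟩ := hP; ⟨_, p, hp, rfl⟩
  obtain ⟨p, hp, hn⟩ := Nat.find_spec h
  exact ⟨p, hp, fun b hb => hn ▸ Nat.find_min' h ⟨b, hb, rfl⟩⟩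

end

variable {G : Type*} [Group G]

/-- A left-invariant, proper, geodesic metric on a group, with values in the natural numbers. -/
structure IsGeodesicMetric (d : G → G → ℕ) : Prop where
  eq_zero_iff : ∀ x y, d x y = 0 ↔ x = y
  comm : ∀ x y, d x y = d y x
  tri : ∀ x y z, d x z ≤ d x y + d y z
  left : ∀ g x y, d (g * x) (g * y) = d x y
  geod : ∀ x y, ∃ c : ℕ → G, IsGeod d (d x y) c ∧ c 0 = x ∧ c (d x y) = y
  finite : ∀ n, {g | d 1 g ≤ n}.Finite

/-! ### Projections to contracting sets -/

section Geodesics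

variable {d : G → G → ℕ}

lemma IsGeodesicMetric.self (hd : IsGeodesicMetric d) (x : G) : d x x = 0 :=
  (hd.eq_zero_iff x x).2 rfl

lemma IsGeodesicMetric.translate (hd : IsGeodesicMetric d) {n : ℕ} {c : ℕ → G}
    (hc : IsGeod d n c) (g : G) : IsGeod d n (fun i => g * c i) := by
  intro i j hij hj
  simpa [hd.left] using hc i j hij hj

lemma IsGeodesicMetric.inv_mul (hd : IsGeodesicMetric d) (x y : G) : d 1 (x⁻¹ * y) = d x y := by
  rw [← hd.left x]; simp

lemma IsGeodesicMetric.mul_right (hd : IsGeodesicMetric d) (x y : G) : d x (x * y) = d 1 y := by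
  simpa using hd.left x 1 y

lemma IsGeodesicMetric.inv (hd : IsGeodesicMetric d) (x : G) : d 1 x⁻¹ = d 1 x := by
  rw [← hd.left x]; simp [hd.comm]

lemma IsGeodesicMetric.mul_le (hd : IsGeodesicMetric d) (x y : G) :
    d 1 (x * y) ≤ d 1 x + d 1 y := by
  have := hd.tri 1 x (x * y)
  rwa [hd.mul_right] at this

lemma IsGeodesicMetric.nearest_self (hd : IsGeodesicMetric d) {P : Set G} {p : G} (hp : p ∈ P) :
    Nearest d P p p :=
  ⟨hp, fun b _ => by rw [hd.self]; omega⟩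

lemma IsGeodesicMetric.nearest_smul (hd : IsGeodesicMetric d) {P : Set G} {y p : G} (g : G) :
    Nearest d (g • P) (g * y) (g * p) ↔ Nearest d P y p := by
  constructor
  · rintro ⟨h1, h2⟩
    refine ⟨by simpa using (Set.smul_mem_smul_set_iff (a := g) (s := P) (x := p)).1 h1,
      fun b hb => ?_⟩
    have := h2 (g * b) (Set.smul_mem_smul_set (a := g) hb)
    simpa [hd.left] using this
  · rintro ⟨h1, h2⟩
    refine ⟨Set.smul_mem_smul_set (a := g) h1, ?_⟩
    rintro _ ⟨b, hb, rfl⟩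
    simpa [hd.left] using h2 b hb

lemma IsGeodesicMetric.nearest_inv_mul (hd : IsGeodesicMetric d) {P : Set G} {y p : G} (g : G)
    (h : Nearest d (g • P) y p) : Nearest d P (g⁻¹ * y) (g⁻¹ * p) := by
  rw [← hd.nearest_smul g]; simpa using h

variable {E : ℕ} {P : Set G}

lemma IsGeodesicMetric.contr_smul (hd : IsGeodesicMetric d) (hP : Contr d E P)
    (g : G) : Contr d E (g • P) := by
  intro n c hc p q hp hq hpq
  have h := hP n _ (hd.translate hc g⁻¹) (g⁻¹ * p) (g⁻¹ * q) (hd.nearest_inv_mul g hp)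
    (hd.nearest_inv_mul g hq) (by rwa [hd.left])
  simpa [hd.left] using h

/-- Projections are coarsely Lipschitz. -/
lemma IsGeodesicMetric.dist_nearest_le (hd : IsGeodesicMetric d) (hP : Contr d E P)
    {x y p q : G} (hp : Nearest d P x p) (hq : Nearest d P y q) :
    d p q ≤ d x y + 2 * E := by
  by_cases h : E < d p q
  · obtain ⟨c, hc, h0, h1⟩ := hd.geod x y
    obtain ⟨i, j, hij, hj, hi', hj'⟩ := hP _ c hc p q (by rwa [h0]) (by rwa [h1]) h
    have := hc i j hij hj
    have := hd.tri p (c i) q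
    have := hd.tri (c i) (c j) q
    have := hd.comm p (c i)
    omega
  · omega

/-- A geodesic from `x` to `y` visits the `E`-balls around `p` and `q` in this order, and its three
pieces account for the three distances, with total error `E + 2E + E`. -/
lemma IsGeodesicMetric.dist_ge_of_nearest (hd : IsGeodesicMetric d) (hP : Contr d E P)
    {x y p q : G} (hp : Nearest d P x p)
    (hq : Nearest d P y q) (h : E < d p q) : d x p + d p q + d q y ≤ d x y + 4 * E := by
  obtain ⟨c, hc, h0, h1⟩ := hd.geod x y
  obtain ⟨i, j, hij, hj, hi', hj'⟩ := hP _ c hc p q (by rwa [h0]) (by rwa [h1]) h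
  have := hc i j hij hj
  have := hc 0 i (by omega) (by omega)
  have := hc j _ hj le_rfl
  rw [h0] at *
  rw [h1] at *
  have := hd.tri p (c i) q
  have := hd.tri (c i) (c j) q
  have := hd.comm p (c i)
  have := hd.tri x (c i) p
  have := hd.tri q (c j) y
  have := hd.comm q (c j)
  omega

/-- Geodesics between points of `P` stay close to `P`. -/
lemma IsGeodesicMetric.quasiconvex (hd : IsGeodesicMetric d) (hP : Contr d E P)
    {n : ℕ} {c : ℕ → G} (hc : IsGeod d n c) (h0 : c 0 ∈ P)
    (hn : c n ∈ P) {i : ℕ} (hi : i ≤ n) : ∃ p ∈ P, d (c i) p ≤ 3 * E := by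
  obtain ⟨p, hp⟩ := exists_nearest d ⟨_, h0⟩ (c i)
  have e0 := hc 0 i (by omega) hi
  have en := hc i n hi le_rfl
  have e0n := hc 0 n (by omega) le_rfl
  have c1 := hd.comm (c i) (c 0)
  -- If `p` is far from both endpoints, the geodesic is `E`-close to `p` at a time before `i` and at
  -- one after `i`. These times differ by at most `2E`, so `c i` is near `p` too.
  have hA : E < d (c 0) p → ∃ k ≤ i, d (c k) p ≤ E := fun h => by
    obtain ⟨_, j, -, hj, -, hj'⟩ :=
      hP i c (fun a b hab hb => hc a b hab (by omega)) _ _ (hd.nearest_self h0) hp h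
    exact ⟨j, hj, hj'⟩
  have hB : E < d p (c n) → ∃ k, i ≤ k ∧ k ≤ n ∧ d (c k) p ≤ E := fun h => by
    obtain ⟨k, j, hkj, hj, hk', -⟩ :=
      hP (n - i) _ (hc.sub i (n - i) (by omega)) p (c n) (by simpa using hp)
        (by simpa [show i + (n - i) = n by omega] using hd.nearest_self hn) h
    exact ⟨i + k, by omega, by omega, hk'⟩
  by_cases hA' : E < d (c 0) p
  · obtain ⟨k, hk, hk'⟩ := hA hA'
    have := hc k i hk hi
    by_cases hB' : E < d p (c n)
    · obtain ⟨l, hl, hl2, hl'⟩ := hB hB'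
      have := hc k l (by omega) hl2
      have := hd.tri (c k) p (c l)
      have := hd.tri (c i) (c k) p
      have := hd.comm (c i) (c k)
      have := hd.comm (c l) p
      exact ⟨p, hp.1, by omega⟩
    · have := hc k n (by omega) le_rfl
      have := hd.tri (c k) p (c n)
      exact ⟨c n, hn, by omega⟩
  · by_cases hB' : E < d p (c n)
    · obtain ⟨l, hl, hl2, hl'⟩ := hB hB'
      have := hc 0 l (by omega) hl2
      have := hd.tri (c 0) p (c l)
      have := hd.comm (c l) p
      exact ⟨c 0, h0, by omega⟩
    · have := hd.tri (c 0) p (c n)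
      exact ⟨c 0, h0, by omega⟩

/-- A geodesic whose endpoints have close projections to `P` can be near `P` only near these
projections. -/
lemma IsGeodesicMetric.dist_le_of_near (hd : IsGeodesicMetric d) (hP : Contr d E P)
    {n : ℕ} {c : ℕ → G} (hc : IsGeod d n c) {p q x : G}
    (hp : Nearest d P (c 0) p) (hq : Nearest d P (c n) q) {k r : ℕ} (hpq : d p q ≤ k) (hx : x ∈ P)
    {i : ℕ} (hi : i ≤ n) (hix : d (c i) x ≤ r) : d p x ≤ 3 * E + k + 2 * r := by
  obtain ⟨x', hx'⟩ := exists_nearest d ⟨_, hx⟩ (c i)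
  have h1 := hx'.2 x hx
  have h2 := hd.tri x' (c i) x
  have h3 := hd.comm x' (c i)
  have h4 := hd.tri p x' x
  by_cases hA : E < d p x'
  -- The first half comes close to `p` and the second half close to `q`. As `p` and `q` are
  -- `k`-close, these two times, which surround `i`, differ by at most `2E + k`.
  · obtain ⟨a', b', hle, hle', ha, -⟩ :=
      hP i c (fun a b hab hb => hc a b hab (by omega)) _ _ hp hx' hA
    by_cases hB : E < d x' q
    · obtain ⟨a2, b, hab, hb, -, hb'⟩ :=
        hP (n - i) _ (hc.sub i (n - i) (by omega)) x' q (by simpa using hx')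
          (by simpa [show i + (n - i) = n by omega] using hq) hB
      have := hc a' (i + b) (by omega) (by omega)
      have := hc a' i (by omega) (by omega)
      have := hd.tri (c a') p (c (i + b))
      have := hd.tri p q (c (i + b))
      have := hd.comm q (c (i + b))
      have := hd.tri p (c a') x
      have := hd.tri (c a') (c i) x
      have := hd.comm p (c a')
      omega
    · have := hd.tri p q x'
      have := hd.comm x' q
      omega
  · omega

end Geodesics

/-! ### The axis of a contracting element and transverse elements -/

section Cyclic

/-- The cyclic subgroup generated by `f`, as a set. -/
abbrev axis (f : G) : Set G := Set.range fun i : ℤ => f ^ i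

/-- No nontrivial power of `f` is conjugate by `t` to a power of `f`. -/
def Transverse (f t : G) : Prop := ∀ a b : ℤ, b ≠ 0 → t * f ^ a * t⁻¹ ≠ f ^ b

lemma one_mem_axis (f : G) : (1 : G) ∈ axis f := ⟨0, by simp⟩

lemma zpow_smul_axis (f : G) (k : ℤ) : f ^ k • axis f = axis f := by
  ext x
  constructor
  · rintro ⟨_, ⟨i, rfl⟩, rfl⟩
    exact ⟨k + i, by simp [zpow_add]⟩
  · rintro ⟨i, rfl⟩
    exact ⟨f ^ (i - k), ⟨i - k, rfl⟩, by simp [← zpow_add]⟩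

lemma Transverse.inv {f t : G} (hf : Function.Injective fun k : ℤ => f ^ k) (ht : Transverse f t) :
    Transverse f t⁻¹ := by
  intro a b hb h
  have ha : a ≠ 0 := by
    rintro rfl
    apply hb
    apply hf
    simpa using h.symm
  apply ht b a ha
  rw [← h]
  group

variable {d : G → G → ℕ}

lemma IsGeodesicMetric.nearest_zpow (hd : IsGeodesicMetric d) {f x p : G} (k : ℤ)
    (h : Nearest d (axis f) x p) : Nearest d (axis f) (f ^ k * x) (f ^ k * p) := by
  have := (hd.nearest_smul (f ^ k)).2 h
  rwa [zpow_smul_axis] at this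

lemma IsGeodesicMetric.finite_zpow (hd : IsGeodesicMetric d) {f : G}
    (hf : Function.Injective fun k : ℤ => f ^ k) {a : ℤ} (ha : a ≠ 0) (r : ℕ) :
    {m : ℤ | d 1 (f ^ (a * m)) ≤ r}.Finite := by
  refine Set.Finite.preimage (f := fun m : ℤ => f ^ (a * m)) ?_ (hd.finite r)
  intro m _ n _ h
  exact mul_left_cancel₀ ha (hf h)

lemma IsGeodesicMetric.exists_zpow_gt (hd : IsGeodesicMetric d) {f : G}
    (hf : Function.Injective fun k : ℤ => f ^ k) (r : ℕ) : ∃ m : ℤ, r < d 1 (f ^ m) := by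
  obtain ⟨m, hm⟩ := (hd.finite_zpow hf one_ne_zero r).exists_notMem
  exact ⟨m, by simpa using hm⟩

variable {E : ℕ} {f : G}

/-- Elements commensurating the cyclic group generated by a contracting element are uniformly close
to it. -/
lemma IsGeodesicMetric.dist_axis_le (hd : IsGeodesicMetric d) (hP : Contr d E (axis f))
    (hf : Function.Injective fun k : ℤ => f ^ k) {t : G} (ht : ¬ Transverse f t) :
    ∃ p ∈ axis f, d t p ≤ 4 * E := by
  simp only [Transverse, not_forall, not_not] at ht
  obtain ⟨a, b, hb, hab⟩ := ht
  have ha : a ≠ 0 := by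
    rintro rfl
    apply hb
    apply hf
    simpa using hab.symm
  -- A common multiple of both exponents makes both powers longer than `E`, so that contraction
  -- applies to `t` and to its inverse.
  obtain ⟨m, hm⟩ := ((hd.finite_zpow hf ha E).union (hd.finite_zpow hf hb E)).exists_notMem
  simp only [Set.mem_union, Set.mem_ofPred_eq, not_or, not_le] at hm
  -- The points `s` and `f ^ b * s = s * f ^ a` project to `p` and `f ^ b * p`. Adding this estimate
  -- for `t` and for `t⁻¹` cancels the lengths of the two powers.
  have key : ∀ (s : G) (a b : ℤ), s * f ^ a * s⁻¹ = f ^ b → E < d 1 (f ^ b) →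
      ∀ p, Nearest d (axis f) s p → 2 * d s p + d 1 (f ^ b) ≤ d 1 (f ^ a) + 4 * E := by
    intro s a b h hE p hp
    have hq := hd.nearest_zpow b hp
    have e1 : d p (f ^ b * p) = d 1 (f ^ b) := by
      obtain ⟨k, rfl⟩ := hp.1
      simp only
      rw [← zpow_add, add_comm, zpow_add, hd.mul_right]
    have e2 : d s (f ^ b * s) = d 1 (f ^ a) := by
      rw [← h]; simp [hd.mul_right, mul_assoc]
    have e3 : d (f ^ b * p) (f ^ b * s) = d s p := by rw [hd.left, hd.comm]
    have := hd.dist_ge_of_nearest hP hp hq (by omega)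
    omega
  have hab' : t * f ^ (a * m) * t⁻¹ = f ^ (b * m) := by
    rw [zpow_mul, zpow_mul, ← hab, conj_zpow]
  have hba' : t⁻¹ * f ^ (b * m) * (t⁻¹)⁻¹ = f ^ (a * m) := by
    rw [← hab']; group
  obtain ⟨p, hp⟩ := exists_nearest d ⟨1, one_mem_axis f⟩ t
  obtain ⟨q, hq⟩ := exists_nearest d ⟨1, one_mem_axis f⟩ t⁻¹
  have h1 := key t _ _ hab' hm.2 p hp
  have h2 := key t⁻¹ _ _ hba' hm.1 q hq
  exact ⟨p, hp.1, by omega⟩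

/-- Otherwise `dist_axis_le` puts every element uniformly close to the cyclic group of `f`. Its
cosets then have representatives in a finite ball, so it has finite index. -/
lemma IsGeodesicMetric.exists_transverse (hd : IsGeodesicMetric d) (hP : Contr d E (axis f))
    (hf : Function.Injective fun k : ℤ => f ^ k) (hG : ¬ IsVirtuallyCyclic G) :
    ∃ t, Transverse f t := by
  by_contra! h
  refine hG ⟨Subgroup.zpowers f, inferInstance, ?_⟩
  have : Finite {g | d 1 g ≤ 4 * E} := hd.finite _
  have hs : Function.Surjective
      (fun g : {g | d 1 g ≤ 4 * E} => ((g : G) : G ⧸ Subgroup.zpowers f)) := by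
    intro x
    obtain ⟨g, rfl⟩ := QuotientGroup.mk_surjective x
    obtain ⟨_, ⟨k, rfl⟩, hk⟩ := hd.dist_axis_le hP hf (h g⁻¹)
    refine ⟨⟨g * f ^ k, ?_⟩, ?_⟩
    · have := hd.inv_mul g⁻¹ (f ^ k)
      simp only [inv_inv] at this
      simpa [this] using hk
    · simp only
      rw [eq_comm, QuotientGroup.eq]
      simp
  have := Finite.of_surjective _ hs
  exact Subgroup.finiteIndex_of_finite_quotient

/-- The translate of the axis by a transverse element has bounded projection to the axis. -/
lemma IsGeodesicMetric.bounded_of_transverse (hd : IsGeodesicMetric d) (hP : Contr d E (axis f))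
    {t : G} (ht : Transverse f t) :
    ∃ C, ∀ x ∈ t • axis f, ∀ y ∈ t • axis f, ∀ p q, Nearest d (axis f) x p →
      Nearest d (axis f) y q → d p q ≤ C := by
  classical
  let K : Set ℤ := {k | ∃ j : ℤ, d (f ^ k) (t * f ^ j) ≤ 4 * E}
  -- Infinitely many close pairs would by pigeonhole include two with the same displacement `(f ^
  -- k)⁻¹ * (t * f ^ j)`. Comparing them, `t` conjugates a power of `f` to a nontrivial power of
  -- `f`.
  have hK : K.Finite := by
    by_contra hinf
    choose! j hj using fun (k : ℤ) (hk : k ∈ K) => hk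
    obtain ⟨k, hk, l, hl, hkl, he⟩ := Set.Infinite.exists_ne_map_eq_of_mapsTo hinf
      (f := fun k => (f ^ k)⁻¹ * (t * f ^ j k)) (t := {g | d 1 g ≤ 4 * E})
      (fun k hk => by simpa [hd.inv_mul] using hj k hk) (hd.finite _)
    apply ht (j k - j l) (k - l) (by omega)
    have : t * f ^ j k = f ^ (k - l) * (t * f ^ j l) := by
      rw [zpow_sub, mul_assoc, ← he]; group
    rw [zpow_sub, ← mul_assoc, this]
    group
  obtain ⟨C, hC⟩ := ((hK.prod hK).image (fun z => d (f ^ z.1) (f ^ z.2))).bddAbove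
  refine ⟨E + C, fun x hx y hy p q hp hq => ?_⟩
  by_cases h : E < d p q
  · obtain ⟨c, hc, h0, h1⟩ := hd.geod x y
    obtain ⟨i, j, hij, hj, hi', hj'⟩ := hP _ c hc p q (by rwa [h0]) (by rwa [h1]) h
    have hmem : ∀ k : ℤ, ∀ i ≤ d x y, d (c i) (f ^ k) ≤ E → k ∈ K := by
      intro k i hi hik
      obtain ⟨_, ⟨_, ⟨l, rfl⟩, rfl⟩, hr'⟩ :=
        hd.quasiconvex (hd.contr_smul hP t) hc (by rwa [h0]) (by rwa [h1]) hi
      refine ⟨l, ?_⟩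
      simp only [smul_eq_mul] at hr'
      have := hd.tri (f ^ k) (c i) (t * f ^ l)
      have := hd.comm (f ^ k) (c i)
      omega
    obtain ⟨k, rfl⟩ := hp.1
    obtain ⟨l, rfl⟩ := hq.1
    have := hC ⟨(k, l), ⟨hmem k i (by omega) hi', hmem l j hj hj'⟩, rfl⟩
    simp only at this ⊢
    omega
  · omega

/-- Every point projects close to `1` after translating by `1` or by a fixed transverse element. -/
lemma IsGeodesicMetric.exists_nearest_le (hd : IsGeodesicMetric d) (hP : Contr d E (axis f))
    (hf : Function.Injective fun k : ℤ => f ^ k) {t : G} (ht : Transverse f t) :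
    ∃ C, ∀ x, ∃ s, (s = 1 ∨ s = t) ∧ ∀ p, Nearest d (axis f) (s * x) p → d 1 p ≤ C := by
  obtain ⟨C₁, h₁⟩ := hd.bounded_of_transverse hP ht
  obtain ⟨C₂, h₂⟩ := hd.bounded_of_transverse hP (ht.inv hf)
  refine ⟨6 * E + C₁ + C₂ + 2 * d 1 t, fun x => ?_⟩
  by_contra! hcon
  obtain ⟨p, hp, hpC⟩ := hcon 1 (Or.inl rfl)
  obtain ⟨q, hq, hqC⟩ := hcon t (Or.inr rfl)
  rw [one_mul] at hp
  have hne : (axis f).Nonempty := ⟨1, one_mem_axis f⟩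
  -- the projections of `p` and `1` to `t⁻¹ • axis f`, translated by `t`
  obtain ⟨r, hr⟩ := exists_nearest d hne (t * p)
  obtain ⟨r₀, hr₀⟩ := exists_nearest d hne t
  have hr₀' : d t r₀ ≤ d 1 t := by rw [hd.comm 1 t]; exact hr₀.2 1 (one_mem_axis f)
  have hrr := h₁ (t * p) (Set.smul_mem_smul_set (a := t) hp.1) t
    ⟨1, one_mem_axis f, by simp⟩ r r₀ hr hr₀
  -- the projections of `t⁻¹ * q` and `t⁻¹`
  obtain ⟨s, hs⟩ := exists_nearest d hne (t⁻¹ * q)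
  obtain ⟨s₀, hs₀⟩ := exists_nearest d hne t⁻¹
  have hs₀' : d t⁻¹ s₀ ≤ d 1 t := by
    rw [← hd.inv t, hd.comm 1 t⁻¹]; exact hs₀.2 1 (one_mem_axis f)
  have hss := h₂ (t⁻¹ * q) (Set.smul_mem_smul_set (a := t⁻¹) hq.1) t⁻¹
    ⟨1, one_mem_axis f, by simp⟩ s s₀ hs hs₀
  have e1 : d (t * x) q = d x (t⁻¹ * q) := by rw [← hd.left t x]; simp
  have e2 : d q (t * p) = d (t⁻¹ * q) p := by rw [← hd.left t _ p]; simp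
  have e3 := hd.left t x p
  have i1 : d 1 r ≤ C₁ + 2 * d 1 t := by
    have := hd.tri 1 t r
    have := hd.tri t r₀ r
    have := hd.comm r r₀
    omega
  have i2 : d 1 s ≤ C₂ + 2 * d 1 t := by
    have := hd.tri 1 t⁻¹ s
    have := hd.tri t⁻¹ s₀ s
    have := hd.comm s s₀
    have := hd.inv t
    omega
  have j1 : E < d q r := by
    have := hd.tri 1 r q
    have := hd.comm q r
    omega
  have j2 : 6 * E < d p s := by
    have := hd.tri 1 s p
    have := hd.comm p s
    omega
  -- A Behrstock-type inequality: the axis and its translate by `t⁻¹` project boundedly to each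
  -- other, so `x` cannot project far out on both. In the sum of `k1` and `k2` the distances from
  -- `x` cancel, which leaves at most `8E` for a quantity exceeding `8E`.
  have k1 := hd.dist_ge_of_nearest hP hq hr j1
  have k2 := hd.dist_ge_of_nearest hP hp hs (by omega)
  have k3 := hd.dist_nearest_le hP (hd.nearest_self hp.1) hs
  have := hd.tri q r (t * p)
  have := hd.tri p s (t⁻¹ * q)
  have := hd.comm p (t⁻¹ * q)
  omega

end Cyclic

/-! ### Barriers and concatenation of elements -/

section Extension

variable {d : G → G → ℕ} {E : ℕ} {f : G} {N : ℤ}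

/-- The translate `x • axis f` is a barrier between `y` and `z`: the projections of `y` and `z` to
it are `B`-close to `x` and to `x * f ^ N`. -/
def Barrier (d : G → G → ℕ) (f : G) (N : ℤ) (B : ℕ) (y z x : G) : Prop :=
  (∀ p, Nearest d (x • axis f) y p → d x p ≤ B) ∧
    ∀ q, Nearest d (x • axis f) z q → d (x * f ^ N) q ≤ B

lemma smul_axis_nonempty (x f : G) : (x • axis f).Nonempty := ⟨x, 1, one_mem_axis f, by simp⟩

/-- The length condition on `f ^ N` keeps the two projections more than `E` apart, so contraction
forces the geodesic through both ends of the barrier. -/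
lemma IsGeodesicMetric.barrier_pass (hd : IsGeodesicMetric d) (hP : Contr d E (axis f)) {B : ℕ}
    {x y z : G} (hB : Barrier d f N B y z x) (hN : 2 * B + E < d 1 (f ^ N)) {n : ℕ} {c : ℕ → G}
    (hc : IsGeod d n c) (h0 : c 0 = y) (hn : c n = z) :
    ∃ i j, i ≤ j ∧ j ≤ n ∧ d (c i) x ≤ B + E ∧ d (c j) (x * f ^ N) ≤ B + E := by
  obtain ⟨p, hp⟩ := exists_nearest d (smul_axis_nonempty x f) y
  obtain ⟨q, hq⟩ := exists_nearest d (smul_axis_nonempty x f) z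
  have h1 := hB.1 p hp
  have h2 := hB.2 q hq
  have h3 := hd.tri x p (x * f ^ N)
  have h4 := hd.tri p q (x * f ^ N)
  have h5 := hd.comm (x * f ^ N) q
  rw [hd.mul_right] at h3
  obtain ⟨i, j, hij, hj, hi', hj'⟩ := hd.contr_smul hP x n c hc p q (by rwa [h0]) (by rwa [hn])
    (by omega)
  have h6 := hd.tri (c i) p x
  have h7 := hd.tri (c j) q (x * f ^ N)
  have h8 := hd.comm p x
  exact ⟨i, j, hij, hj, by omega, by omega⟩

/-- Moving an endpoint by `r` moves its projection by at most `r + 2E`. -/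
lemma IsGeodesicMetric.barrier_left (hd : IsGeodesicMetric d) (hP : Contr d E (axis f)) {B : ℕ}
    {x y z : G} (hB : Barrier d f N B y z x) {y' : G} {r : ℕ} (h : d y' y ≤ r) :
    Barrier d f N (B + r + 2 * E) y' z x := by
  refine ⟨fun p hp => ?_, fun q hq => (hB.2 q hq).trans (by omega)⟩
  obtain ⟨p', hp'⟩ := exists_nearest d (smul_axis_nonempty x f) y
  have h1 := hB.1 p' hp'
  have h2 := hd.dist_nearest_le (hd.contr_smul hP x) hp hp'
  have h3 := hd.tri x p' p
  have h4 := hd.comm p p'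
  omega

lemma IsGeodesicMetric.barrier_right (hd : IsGeodesicMetric d) (hP : Contr d E (axis f)) {B : ℕ}
    {x y z : G} (hB : Barrier d f N B y z x) {z' : G} {r : ℕ} (h : d z' z ≤ r) :
    Barrier d f N (B + r + 2 * E) y z' x := by
  refine ⟨fun p hp => (hB.1 p hp).trans (by omega), fun q hq => ?_⟩
  obtain ⟨q', hq'⟩ := exists_nearest d (smul_axis_nonempty x f) z
  have h1 := hB.2 q' hq'
  have h2 := hd.dist_nearest_le (hd.contr_smul hP x) hq hq'
  have h3 := hd.tri (x * f ^ N) q' q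
  have h4 := hd.comm q q'
  omega

/-- A barrier between the endpoints of a geodesic is also a barrier for the points of the geodesic
that come well after it. -/
lemma IsGeodesicMetric.barrier_truncate (hd : IsGeodesicMetric d) (hP : Contr d E (axis f)) {B : ℕ}
    {x y z : G} (hB : Barrier d f N B y z x) {n : ℕ} {c : ℕ → G} (hc : IsGeod d n c)
    (hn : c n = z) {j k : ℕ} (hj : d (c j) (x * f ^ N) ≤ B + E) (hjk : j + 2 * B + 2 * E + 1 ≤ k)
    (hk : k ≤ n) : Barrier d f N (B + E) y (c k) x := by
  refine ⟨fun p hp => (hB.1 p hp).trans (by omega), fun q' hq' => ?_⟩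
  obtain ⟨q, hq⟩ := exists_nearest d (smul_axis_nonempty x f) z
  have h1 := hB.2 q hq
  have h2 := hd.tri (x * f ^ N) q q'
  have h3 := hd.comm q' q
  -- If the projections of `c k` and `z` differed much, the geodesic would return close to `q` after
  -- time `k`. It was near there at time `j` already, and `k - j` is too large for that.
  by_cases h : E < d q' q
  · obtain ⟨_, l, -, hl, -, hl'⟩ :=
      hd.contr_smul hP x (n - k) _ (hc.sub k (n - k) (by omega)) q' q (by simpa using hq')
        (by simpa [show k + (n - k) = n by omega, hn] using hq) h
    have := hc j (k + l) (by omega) (by omega)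
    have := hd.tri (c j) (x * f ^ N) (c (k + l))
    have := hd.tri (x * f ^ N) q (c (k + l))
    have := hd.comm q (c (k + l))
    omega
  · omega

lemma IsGeodesicMetric.barrier_smul (hd : IsGeodesicMetric d) {B : ℕ} {x y z : G}
    (hB : Barrier d f N B y z x) (g : G) : Barrier d f N B (g * y) (g * z) (g * x) := by
  have key : ∀ w p, Nearest d ((g * x) • axis f) (g * w) p →
      Nearest d (x • axis f) w (g⁻¹ * p) := by
    intro w p hp
    rw [mul_smul] at hp
    simpa using hd.nearest_inv_mul g hp
  refine ⟨fun p hp => ?_, fun q hq => ?_⟩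
  · have := hB.1 _ (key _ _ hp)
    rwa [← hd.left g, mul_inv_cancel_left] at this
  · have := hB.2 _ (key _ _ hq)
    rwa [← hd.left g, mul_inv_cancel_left, ← mul_assoc] at this

/-- The data of an extension: every point `x`, moved by a short element `s x`, projects close to `1`
on the axis of `f`, and `f ^ N` is long. -/
structure IsExtender (d : G → G → ℕ) (f : G) (N : ℤ) (ρ : ℕ) (s : G → G) : Prop where
  contr : Contr d ρ (axis f)
  short : ∀ x, d 1 (s x) ≤ ρ
  near : ∀ x p, Nearest d (axis f) (s x * x) p → d 1 p ≤ ρ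
  -- The weakest barrier used has constant `12 * ρ`, and `barrier_pass` then needs `2 * 12 * ρ + ρ`.
  long : 25 * ρ < d 1 (f ^ N)

/-- The element joining `g` to `h` in the extension of `g` by `h`. -/
def bridge (f : G) (N : ℤ) (s : G → G) (g h : G) : G := (s g⁻¹)⁻¹ * f ^ N * s h

/-- The extension of `g` by `h`. -/
def extend (f : G) (N : ℤ) (s : G → G) (g h : G) : G := g * bridge f N s g h * h

variable {ρ : ℕ} {s : G → G}

lemma IsExtender.bridge_le (hs : IsExtender d f N ρ s) (hd : IsGeodesicMetric d) (g h : G) :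
    d 1 (bridge f N s g h) ≤ d 1 (f ^ N) + 2 * ρ := by
  have h1 := hd.mul_le ((s g⁻¹)⁻¹ * f ^ N) (s h)
  have h2 := hd.mul_le (s g⁻¹)⁻¹ (f ^ N)
  have h3 := hd.inv (s g⁻¹)
  have h4 := hs.short g⁻¹
  have h5 := hs.short h
  unfold bridge
  omega

lemma IsExtender.extend_le (hs : IsExtender d f N ρ s) (hd : IsGeodesicMetric d) (g h : G) :
    d 1 (extend f N s g h) ≤ d 1 g + d 1 h + (d 1 (f ^ N) + 2 * ρ) := by
  have h1 := hd.mul_le (g * bridge f N s g h) h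
  have h2 := hd.mul_le g (bridge f N s g h)
  have h3 := hs.bridge_le hd g h
  unfold extend
  omega

/-- The corrections by `s` serve this purpose: seen from the barrier, the endpoints become `s g⁻¹ *
g⁻¹` and, after a shift by `f ^ N`, `s h * h`. Both project near `1`. -/
lemma IsExtender.barrier (hs : IsExtender d f N ρ s) (hd : IsGeodesicMetric d) (g h : G) :
    Barrier d f N ρ 1 (extend f N s g h) (g * (s g⁻¹)⁻¹) := by
  refine ⟨fun p hp => ?_, fun q hq => ?_⟩
  · have := hd.nearest_inv_mul _ hp
    rw [← hd.inv_mul]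
    refine hs.near g⁻¹ _ ?_
    simpa using this
  · have := hd.nearest_zpow (-N) (hd.nearest_inv_mul _ hq)
    rw [← hd.inv_mul]
    refine hs.near h _ ?_
    convert this using 1
    · simp only [extend, bridge]; group
    · group

/-- Geodesics from `1` to the extension of `g` by `h` pass near `g` and then near the other end of
the bridge. -/
lemma IsExtender.pass (hs : IsExtender d f N ρ s) (hd : IsGeodesicMetric d) (g h : G) {n : ℕ}
    {c : ℕ → G} (hc : IsGeod d n c) (h0 : c 0 = 1) (hn : c n = extend f N s g h) :
    ∃ i j, i ≤ j ∧ j ≤ n ∧ d (c i) g ≤ 3 * ρ ∧ d (c j) (g * bridge f N s g h) ≤ 3 * ρ ∧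
      d (c j) (g * (s g⁻¹)⁻¹ * f ^ N) ≤ 2 * ρ := by
  have hl := hs.long
  obtain ⟨i, j, hij, hj, hi', hj'⟩ :=
    hd.barrier_pass hs.contr (hs.barrier hd g h) (by omega) hc h0 hn
  have h1 : d (g * (s g⁻¹)⁻¹) g ≤ ρ := by
    rw [hd.comm, hd.mul_right, hd.inv]; exact hs.short _
  have h2 : d (g * (s g⁻¹)⁻¹ * f ^ N) (g * bridge f N s g h) ≤ ρ := by
    rw [bridge, ← mul_assoc, ← mul_assoc, hd.mul_right]; exact hs.short _
  have := hd.tri (c i) (g * (s g⁻¹)⁻¹) g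
  have := hd.tri (c j) (g * (s g⁻¹)⁻¹ * f ^ N) (g * bridge f N s g h)
  exact ⟨i, j, hij, hj, by omega, by omega, by omega⟩

/-- If an element is obtained both by inserting `b` after `a` and by extending a much longer element
`a'`, then geodesics from `1` to `a'` pass near a copy of `b`. -/
lemma IsExtender.exists_passage (hs : IsExtender d f N ρ s) (hd : IsGeodesicMetric d)
    {a b c a' h' : G} (hz : extend f N s a (extend f N s b c) = extend f N s a' h')
    (hlen : d 1 a + d 1 b + (2 * d 1 (f ^ N) + 33 * ρ) < d 1 a') {m : ℕ} {e : ℕ → G}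
    (he : IsGeod d m e) (he0 : e 0 = 1) (hem : e m = a') :
    ∃ x, ∃ i ≤ m, ∃ j ≤ m, d (e i) x ≤ 14 * ρ ∧ d (e j) (x * b) ≤ 14 * ρ := by
  have hl := hs.long
  set w := a * bridge f N s a (extend f N s b c) with hw
  set z := extend f N s a (extend f N s b c) with hzdef
  have hzw : z = w * extend f N s b c := rfl
  set x₁ := a * (s a⁻¹)⁻¹ with hx₁
  set x₂ := w * (b * (s b⁻¹)⁻¹) with hx₂
  -- A geodesic to the common element `z` crosses both barriers around the copy of `b` and only
  -- later passes near `a'`. Truncating there transfers the barriers to the endpoint `a'`, hence to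
  -- `e`.
  obtain ⟨κ, hκ, hκ0, hκn⟩ := hd.geod 1 z
  set n := d 1 z
  have bar₁ : Barrier d f N ρ 1 z x₁ := hs.barrier hd a _
  have bar₂ : Barrier d f N ρ w z x₂ := by
    have := hd.barrier_smul (hs.barrier hd b c) w
    rwa [mul_one] at this
  obtain ⟨i₁, j₁, hij₁, hj₁, hi₁a, hj₁w, hj₁x⟩ := hs.pass hd a (extend f N s b c) hκ hκ0 hκn
  have bar₂' : Barrier d f N (6 * ρ) (κ j₁) z x₂ := by
    have := hd.barrier_left hs.contr bar₂ hj₁w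
    rwa [show ρ + 3 * ρ + 2 * ρ = 6 * ρ by omega] at this
  obtain ⟨i₂, j₂, hij₂, hj₂, hi₂', hj₂'⟩ := hd.barrier_pass hs.contr bar₂' (by omega)
    (hκ.sub j₁ (n - j₁) (by omega)) (by simp) (by simpa [show j₁ + (n - j₁) = n by omega] using hκn)
  obtain ⟨i', j', hij', hjn', hia', -, -⟩ := hs.pass hd a' h' hκ hκ0 (hκn.trans hz)
  -- the position of `a'` is well after both barriers
  have hi' : i' + 3 * ρ ≥ d 1 a' := by
    have := hκ.dist_zero (i := i') (by omega)
    rw [hκ0] at this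
    have := hd.tri 1 (κ i') a'
    omega
  have hi₁ : i₁ ≤ d 1 a + 3 * ρ := by
    have := hκ.dist_zero (i := i₁) (by omega)
    rw [hκ0] at this
    have := hd.tri 1 a (κ i₁)
    have := hd.comm a (κ i₁)
    omega
  have hx₂b : d x₂ (w * b) ≤ ρ := by
    rw [hx₂, hd.left, hd.comm, hd.mul_right, hd.inv]; exact hs.short _
  -- With the error `3 * ρ` in `i₁`, the margin `14 * ρ` of `barrier_truncate` and the error `3 * ρ`
  -- in `i'`, this accounts for the constant `33 * ρ` in `hlen`.
  have hj₂i : j₁ + j₂ ≤ i₁ + d 1 b + (2 * d 1 (f ^ N) + 13 * ρ) := by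
    have h1 := hκ i₁ (j₁ + j₂) (by omega) (by omega)
    have h2 := hd.tri (κ i₁) a (κ (j₁ + j₂))
    have h3 := hd.tri a w (κ (j₁ + j₂))
    have h4 := hd.tri w (w * b) (κ (j₁ + j₂))
    have h5 := hd.tri (w * b) x₂ (κ (j₁ + j₂))
    have h6 := hd.tri x₂ (x₂ * f ^ N) (κ (j₁ + j₂))
    have h7 := hd.comm (x₂ * f ^ N) (κ (j₁ + j₂))
    have h8 := hd.comm x₂ (w * b)
    have h9 := hs.bridge_le hd a (extend f N s b c)
    rw [hd.mul_right] at h4 h6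
    rw [hw, hd.mul_right, ← hw] at h3
    omega
  have tb₁ : Barrier d f N (7 * ρ) 1 a' x₁ := by
    have := hd.barrier_right hs.contr (hd.barrier_truncate hs.contr bar₁ hκ hκn (j := j₁) (k := i')
      (hj₁x.trans (by omega)) (by omega) (by omega)) (z' := a') (r := 3 * ρ)
      (by rw [hd.comm]; exact hia')
    rwa [show ρ + ρ + 3 * ρ + 2 * ρ = 7 * ρ by omega] at this
  have tb₂ : Barrier d f N (12 * ρ) (κ j₁) a' x₂ := by
    have := hd.barrier_right hs.contr (hd.barrier_truncate hs.contr bar₂' hκ hκn (j := j₁ + j₂)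
      (k := i') hj₂' (by omega) (by omega)) (z' := a') (r := 3 * ρ) (by rw [hd.comm]; exact hia')
    rwa [show 6 * ρ + ρ + 3 * ρ + 2 * ρ = 12 * ρ by omega] at this
  obtain ⟨_, k, -, hk, -, hk'⟩ := hd.barrier_pass hs.contr tb₁ (by omega) he he0 hem
  have hkw : d (e k) w ≤ 9 * ρ := by
    have : d (x₁ * f ^ N) w ≤ ρ := by
      rw [hw, hx₁, bridge, ← mul_assoc, ← mul_assoc, hd.mul_right]; exact hs.short _
    have := hd.tri (e k) (x₁ * f ^ N) w
    omega
  -- The near end is controlled through `w`, which `e` visits; the far end comes from `tb₂`.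
  -- Crossing gives `13 * ρ`, and passing from `x₂` to `w * b` costs one more `ρ`.
  have bar₃ : Barrier d f N (12 * ρ) (e k) a' x₂ := by
    refine ⟨fun p hp => ?_, tb₂.2⟩
    have := (hd.barrier_left hs.contr bar₂ hkw).1 p hp
    omega
  obtain ⟨l, l', hl1, hl2, hl', -⟩ := hd.barrier_pass hs.contr bar₃ (by omega)
    (he.sub k (m - k) (by omega)) (by simp) (by simpa [show k + (m - k) = m by omega] using hem)
  have := hd.tri (e (k + l)) x₂ (w * b)
  exact ⟨w, k, hk, k + l, by omega, by omega, by omega⟩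

/-- A group that is not virtually cyclic and has a contracting element admits extensions. -/
lemma IsGeodesicMetric.exists_isExtender (hd : IsGeodesicMetric d) (hP : Contr d E (axis f))
    (hf : Function.Injective fun k : ℤ => f ^ k) {t : G} (ht : Transverse f t) :
    ∃ N ρ s, IsExtender d f N ρ s := by
  obtain ⟨C, hC⟩ := hd.exists_nearest_le hP hf ht
  choose s hs1 hs2 using hC
  obtain ⟨N, hN⟩ := hd.exists_zpow_gt hf (25 * (C + E + d 1 t))
  refine ⟨N, C + E + d 1 t, s, ?_, ?_, ?_, hN⟩
  · intro n c hc p q hp hq hpq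
    obtain ⟨i, j, h1, h2, h3, h4⟩ := hP n c hc p q hp hq (by omega)
    exact ⟨i, j, h1, h2, by omega, by omega⟩
  · intro x
    rcases hs1 x with h | h <;> rw [h]
    · rw [hd.self]; omega
    · omega
  · intro x p hp
    have := hs2 x p hp
    omega

end Extension

/-! ### Cardinality of fibres, images and products -/

section Ncard

lemma ncard_le_mul_ncard {α β : Type*} {A : Set α} {B : Set β} (hA : A.Finite) (hB : B.Finite)
    (φ : α → β) (hφ : Set.MapsTo φ A B) (M : ℕ) (h : ∀ b, {a ∈ A | φ a = b}.ncard ≤ M) :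
    A.ncard ≤ M * B.ncard := by
  classical
  rw [Set.ncard_eq_toFinset_card _ hA, Set.ncard_eq_toFinset_card _ hB]
  refine Finset.card_le_mul_card_image_of_maps_to (f := φ) (fun a ha => ?_) M fun b _ => ?_
  · simpa using hφ (by simpa using ha)
  · refine le_trans (le_of_eq ?_) (h b)
    rw [← Set.ncard_coe_finset]
    congr 1
    ext a
    simp

lemma ncard_le_of_subset_image {α β : Type*} {A : Set α} {B : Set β} (hA : A.Finite) (φ : α → β)
    (h : B ⊆ φ '' A) : B.ncard ≤ A.ncard :=
  (Set.ncard_le_ncard h (hA.image φ)).trans (Set.ncard_image_le hA)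

lemma ncard_mul_le {G : Type*} [Group G] {A B : Set G} (hA : A.Finite) (hB : B.Finite) :
    (A * B).ncard ≤ A.ncard * B.ncard := by
  rw [← Set.ncard_prod]
  refine ncard_le_of_subset_image (hA.prod hB) (fun z => z.1 * z.2) ?_
  rintro _ ⟨a, ha, b, hb, rfl⟩
  exact ⟨(a, b), ⟨ha, hb⟩, rfl⟩

end Ncard

/-! ### Growth of balls and rarity of avoiding elements -/

section Counting

/-- The closed ball of radius `n` around `1`. -/
def bset (d : G → G → ℕ) (n : ℕ) : Set G := {g | d 1 g ≤ n}

/-- The sphere of radius `n` around `1`. -/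
def sset (d : G → G → ℕ) (n : ℕ) : Set G := {g | d 1 g = n}

/-- The elements at distance `m` from `1` that are joined to `1` by a geodesic which does not pass
`R`-close to both ends of a translate of the segment from `1` to `b`. -/
def avoiding (d : G → G → ℕ) (R : ℕ) (b : G) (m : ℕ) : Set G :=
  {g | ∃ c, IsGeod d m c ∧ c 0 = 1 ∧ c m = g ∧
    ∀ x, ∀ i ≤ m, ∀ j ≤ m, ¬ (d (c i) x ≤ R ∧ d (c j) (x * b) ≤ R)}

variable {d : G → G → ℕ}

lemma IsGeodesicMetric.finite_bset (hd : IsGeodesicMetric d) (n : ℕ) : (bset d n).Finite :=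
  hd.finite n

lemma sset_subset_bset (d : G → G → ℕ) (n : ℕ) : sset d n ⊆ bset d n := fun _ hg => le_of_eq hg

lemma IsGeodesicMetric.finite_sset (hd : IsGeodesicMetric d) (n : ℕ) : (sset d n).Finite :=
  (hd.finite_bset n).subset (sset_subset_bset d n)

lemma avoiding_subset_sset (d : G → G → ℕ) (R : ℕ) (b : G) (m : ℕ) :
    avoiding d R b m ⊆ sset d m := by
  rintro g ⟨c, hc, h0, rfl, -⟩
  have := hc.dist_zero le_rfl
  rwa [h0] at this

lemma IsGeodesicMetric.finite_avoiding (hd : IsGeodesicMetric d) (R : ℕ) (b : G) (m : ℕ) :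
    (avoiding d R b m).Finite :=
  (hd.finite_sset m).subset (avoiding_subset_sset d R b m)

lemma IsGeodesicMetric.ncard_bset_mono (hd : IsGeodesicMetric d) {m n : ℕ} (h : m ≤ n) :
    (bset d m).ncard ≤ (bset d n).ncard :=
  Set.ncard_le_ncard (fun _ hg => le_trans (b := m) hg h) (hd.finite_bset n)

lemma IsGeodesicMetric.ncard_bset_pos (hd : IsGeodesicMetric d) (n : ℕ) : 0 < (bset d n).ncard := by
  rw [Set.ncard_pos (hd.finite_bset n)]
  exact ⟨1, by simp [bset, hd.self]⟩

lemma IsGeodesicMetric.ncard_bset_add_le (hd : IsGeodesicMetric d) (m n : ℕ) :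
    (bset d (m + n)).ncard ≤ (bset d m).ncard * (bset d n).ncard := by
  refine le_trans (Set.ncard_le_ncard ?_ ((hd.finite_bset m).mul (hd.finite_bset n)))
    (ncard_mul_le (hd.finite_bset m) (hd.finite_bset n))
  intro g hg
  obtain ⟨c, hc, h0, h1⟩ := hd.geod 1 g
  have hg : d 1 g ≤ m + n := hg
  refine ⟨c (min m (d 1 g)), ?_, (c (min m (d 1 g)))⁻¹ * g, ?_, by simp⟩
  · have := hc.dist_zero (i := min m (d 1 g)) (by omega)
    rw [h0] at this
    simp only [bset, Set.mem_ofPred_eq]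
    omega
  · have := hc (min m (d 1 g)) _ (by omega) le_rfl
    rw [h1] at this
    simp only [bset, Set.mem_ofPred_eq, hd.inv_mul]
    omega

lemma IsGeodesicMetric.ncard_bset_add_le_pow (hd : IsGeodesicMetric d) (m n : ℕ) :
    (bset d (m + n)).ncard ≤ (bset d 1).ncard ^ n * (bset d m).ncard := by
  induction n with
  | zero => simp
  | succ n ih =>
    calc (bset d (m + n + 1)).ncard ≤ (bset d (m + n)).ncard * (bset d 1).ncard :=
          hd.ncard_bset_add_le _ _
      _ ≤ ((bset d 1).ncard ^ n * (bset d m).ncard) * (bset d 1).ncard := by gcongr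
      _ = _ := by ring

lemma IsGeodesicMetric.ncard_bset_eq_sum (hd : IsGeodesicMetric d) (n : ℕ) :
    (bset d n).ncard = ∑ i ∈ Finset.range (n + 1), (sset d i).ncard := by
  induction n with
  | zero => simp [bset, sset]
  | succ n ih =>
    rw [Finset.sum_range_succ, ← ih, ← Set.ncard_union_eq _ (hd.finite_bset n) (hd.finite_sset _)]
    · congr 1
      ext g
      simp only [bset, sset, Set.mem_union, Set.mem_ofPred_eq]
      omega
    · rw [Set.disjoint_left]
      intro g hg hg'
      simp only [bset, sset, Set.mem_ofPred_eq] at hg hg'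
      omega

/-- Cutting the witnessing geodesic at time `m` leaves two geodesics that inherit the avoidance,
which is invariant under translation. -/
lemma IsGeodesicMetric.avoiding_add_subset (hd : IsGeodesicMetric d) (R : ℕ) (b : G) (m n : ℕ) :
    avoiding d R b (m + n) ⊆ avoiding d R b m * avoiding d R b n := by
  rintro g ⟨c, hc, h0, rfl, hav⟩
  refine ⟨c m, ⟨c, fun i j hij hj => hc i j hij (by omega), h0, rfl,
    fun x i hi j hj => hav x i (by omega) j (by omega)⟩, (c m)⁻¹ * c (m + n),
    ⟨fun i => (c m)⁻¹ * c (m + i), hd.translate (hc.sub m n le_rfl) _, by simp, rfl, ?_⟩, by simp⟩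
  rintro x i hi j hj ⟨h1, h2⟩
  refine hav (c m * x) (m + i) (by omega) (m + j) (by omega) ⟨?_, ?_⟩
  · rw [← hd.left (c m)] at h1; simpa using h1
  · rw [← hd.left (c m)] at h2; simpa [mul_assoc] using h2

lemma IsGeodesicMetric.ncard_avoiding_mul_le (hd : IsGeodesicMetric d) (R : ℕ) (b : G) (m k : ℕ) :
    (avoiding d R b (k * m)).ncard ≤ (avoiding d R b m).ncard ^ k := by
  induction k with
  | zero =>
    rw [pow_zero, zero_mul, Set.ncard_le_one_iff (hd.finite_avoiding ..)]
    rintro x y ⟨c, -, h0, rfl, -⟩ ⟨c', -, h0', rfl, -⟩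
    rw [h0, h0']
  | succ k ih =>
    rw [add_mul, one_mul, pow_succ]
    refine (Set.ncard_le_ncard (hd.avoiding_add_subset R b _ m) ((hd.finite_avoiding ..).mul
      (hd.finite_avoiding ..))).trans ((ncard_mul_le (hd.finite_avoiding ..)
      (hd.finite_avoiding ..)).trans ?_)
    gcongr

variable {f : G} {N : ℤ} {ρ : ℕ} {s : G → G}

/-- This decodes extensions: the result and the length of `g` alone locate `g` up to `6 * ρ`. -/
lemma IsExtender.dist_le_of_extend (hs : IsExtender d f N ρ s) (hd : IsGeodesicMetric d) (g h : G)
    {n : ℕ} {c : ℕ → G} (hc : IsGeod d n c) (h0 : c 0 = 1) (hn : c n = extend f N s g h) :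
    d (c (min (d 1 g) n)) g ≤ 6 * ρ := by
  obtain ⟨i, j, hij, hj, hi, -, -⟩ := hs.pass hd g h hc h0 hn
  have h1 := hc.dist_zero (i := i) (by omega)
  rw [h0] at h1
  have h2 := hd.tri 1 (c i) g
  have h3 := hd.tri 1 g (c i)
  have h4 := hd.comm g (c i)
  have h5 := hd.tri (c (min (d 1 g) n)) (c i) g
  have h6 : d (c (min (d 1 g) n)) (c i) ≤ 3 * ρ := by
    rcases le_total i (min (d 1 g) n) with h | h
    · have := hc i _ h (by omega)
      rw [hd.comm]
      omega
    · have := hc _ i h (by omega)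
      omega
  omega

/-- Extension has bounded fibres once the length of the first factor is prescribed, hence the
sphere: a correction in a ball and the bridge recover `g`, then `h`. The additive length of the
bridge costs only a constant factor. -/
lemma IsExtender.ncard_sset_mul_le (hs : IsExtender d f N ρ s) (hd : IsGeodesicMetric d) :
    ∃ C, 0 < C ∧ ∀ i j, (sset d i).ncard * (bset d j).ncard ≤ C * (bset d (i + j)).ncard := by
  set φ := d 1 (f ^ N) + 2 * ρ with hφ
  refine ⟨(bset d (6 * ρ)).ncard * (bset d φ).ncard * (bset d 1).ncard ^ φ, ?_, fun i j => ?_⟩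
  · have := hd.ncard_bset_pos
    have h1 := this (6 * ρ)
    have h2 := this φ
    have h3 := this 1
    positivity
  rw [← Set.ncard_prod, mul_assoc]
  refine (ncard_le_mul_ncard ((hd.finite_sset i).prod (hd.finite_bset j))
    (hd.finite_bset (i + j + φ)) (fun z => extend f N s z.1 z.2) ?_ _ fun z => ?_).trans
    (Nat.mul_le_mul_left _ (hd.ncard_bset_add_le_pow (i + j) φ))
  · rintro ⟨g, h⟩ ⟨hg, hh⟩
    have := hs.extend_le hd g h
    simp only [sset, bset, Set.mem_ofPred_eq] at hg hh ⊢
    omega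
  · obtain ⟨c, hc, h0, h1⟩ := hd.geod 1 z
    rw [← Set.ncard_prod]
    refine ncard_le_of_subset_image ((hd.finite_bset _).prod (hd.finite_bset _))
      (fun u => (c (min i (d 1 z)) * u.1, (c (min i (d 1 z)) * u.1 * u.2)⁻¹ * z)) ?_
    rintro ⟨g, h⟩ ⟨⟨hg, hh⟩, hz⟩
    have hg : d 1 g = i := hg
    have hz : extend f N s g h = z := hz
    refine ⟨((c (min i (d 1 z)))⁻¹ * g, bridge f N s g h), ⟨?_, hs.bridge_le hd g h⟩, ?_⟩
    · have := hs.dist_le_of_extend hd g h hc h0 (h1.trans hz.symm)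
      rw [hg] at this
      simpa only [bset, Set.mem_ofPred_eq, hd.inv_mul] using this
    · simp only [mul_inv_cancel_left]
      rw [← hz, extend, inv_mul_cancel_left]

/-- Elements avoiding `b` become rare, by insertion of `b`. -/
lemma IsExtender.ncard_avoiding_le (hs : IsExtender d f N ρ s) (hd : IsGeodesicMetric d) :
    ∃ C, ∀ b m, (avoiding d (14 * ρ) b m).ncard * (m + 1) ≤
      C * (d 1 b + 1) * (bset d 1).ncard ^ d 1 b * (bset d m).ncard := by
  set φ := d 1 (f ^ N) + 2 * ρ with hφ
  set r := 2 * d 1 (f ^ N) + 33 * ρ with hr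
  set V := (bset d (6 * ρ)).ncard * ((bset d φ).ncard * (bset d φ).ncard) with hV
  refine ⟨(2 * r + 2) * V * (bset d 1).ncard ^ (2 * φ), fun b m => ?_⟩
  have key : (avoiding d (14 * ρ) b m).ncard * (m + 1) ≤
      ((2 * (d 1 b + r) + 1) * V) * (bset d (m + (d 1 b + 2 * φ))).ncard := by
    choose! c hc h0 hm hav using
      fun (g : G) (hg : g ∈ avoiding d (14 * ρ) b m) => hg
    have hcard : (Set.Iic m).ncard = m + 1 := by
      rw [← Finset.coe_Iic, Set.ncard_coe_finset, Nat.card_Iic]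
    rw [← hcard, ← Set.ncard_prod]
    have hlen : ∀ g ∈ avoiding d (14 * ρ) b m, ∀ i ≤ m, d 1 (c g i) = i := fun g hg i hi => by
      have := (hc g hg).dist_zero hi
      rwa [h0 g hg] at this
    refine ncard_le_mul_ncard ((hd.finite_avoiding _ b m).prod (Set.finite_Iic m))
      (hd.finite_bset _)
      (fun z => extend f N s (c z.1 z.2) (extend f N s b ((c z.1 z.2)⁻¹ * z.1))) ?_ _ fun z => ?_
    · rintro ⟨g, i⟩ ⟨hg, hi⟩
      simp only [Set.mem_Iic] at hg hi
      have e1 := hs.extend_le hd (c g i) (extend f N s b ((c g i)⁻¹ * g))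
      have e2 := hs.extend_le hd b ((c g i)⁻¹ * g)
      have e3 := hlen g hg i hi
      have e4 := hc g hg i m hi le_rfl
      rw [hm g hg] at e4
      rw [hd.inv_mul] at e2
      simp only [bset, Set.mem_ofPred_eq]
      omega
    · obtain hemp | ⟨⟨g₀, i₀⟩, ⟨hg₀, hi₀⟩, hz₀⟩ := Set.eq_empty_or_nonempty
        {a ∈ avoiding d (14 * ρ) b m ×ˢ Set.Iic m |
          extend f N s (c a.1 a.2) (extend f N s b ((c a.1 a.2)⁻¹ * a.1)) = z}
      · rw [hemp]; simp
      simp only [Set.mem_Iic] at hg₀ hi₀ hz₀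
      -- Two insertions with the same result take place at nearby positions, since otherwise the
      -- geodesic with the later one would contain a copy of `b`.
      have hclose : ∀ g ∈ avoiding d (14 * ρ) b m, ∀ g' ∈ avoiding d (14 * ρ) b m, ∀ i ≤ m,
          ∀ i' ≤ m, extend f N s (c g i) (extend f N s b ((c g i)⁻¹ * g)) =
            extend f N s (c g' i') (extend f N s b ((c g' i')⁻¹ * g')) → i' ≤ i + d 1 b + r := by
        intro g hg g' hg' i hi i' hi' heq
        by_contra! hlt
        obtain ⟨x, k, hk, l, hl, h1, h2⟩ := hs.exists_passage hd heq
          (by rw [hlen g hg i hi, hlen g' hg' i' hi']; omega)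
          (m := i') (fun a b hab hb => hc g' hg' a b hab (by omega)) (h0 g' hg') rfl
        exact hav g' hg' x k (by omega) l (by omega) ⟨h1, h2⟩
      obtain ⟨κ, hκ, hκ0, hκ1⟩ := hd.geod 1 z
      have hI : (Set.Icc (i₀ - (d 1 b + r)) (i₀ + (d 1 b + r))).ncard ≤ 2 * (d 1 b + r) + 1 := by
        rw [← Finset.coe_Icc, Set.ncard_coe_finset, Nat.card_Icc]
        omega
      -- A point of the fibre is encoded by its position, the correction locating the prefix `c g i`
      -- on a geodesic to `z`, and the two bridges.
      refine le_trans ?_ (Nat.mul_le_mul_right V hI)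
      rw [hV, ← Set.ncard_prod, ← Set.ncard_prod, ← Set.ncard_prod]
      refine ncard_le_of_subset_image ((Set.finite_Icc _ _).prod ((hd.finite_bset _).prod
        ((hd.finite_bset _).prod (hd.finite_bset _))))
        (fun u => (κ (min u.1 (d 1 z)) * u.2.1 *
          ((κ (min u.1 (d 1 z)) * u.2.1 * u.2.2.1 * b * u.2.2.2)⁻¹ * z), u.1)) ?_
      rintro ⟨g, i⟩ ⟨⟨hg, hi⟩, hz⟩
      simp only [Set.mem_Iic] at hg hi hz
      have c1 := hclose g hg g₀ hg₀ i hi i₀ hi₀ (hz.trans hz₀.symm)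
      have c2 := hclose g₀ hg₀ g hg i₀ hi₀ i hi (hz₀.trans hz.symm)
      refine ⟨(i, (κ (min i (d 1 z)))⁻¹ * c g i,
        bridge f N s (c g i) (extend f N s b ((c g i)⁻¹ * g)), bridge f N s b ((c g i)⁻¹ * g)),
        ⟨⟨?_, ?_⟩, ?_, hs.bridge_le hd _ _, hs.bridge_le hd _ _⟩, ?_⟩
      · change i₀ - (d 1 b + r) ≤ i
        omega
      · change i ≤ i₀ + (d 1 b + r)
        omega
      · have := hs.dist_le_of_extend hd (c g i) _ hκ hκ0 (hκ1.trans hz.symm)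
        rw [hlen g hg i hi] at this
        simpa only [bset, Set.mem_ofPred_eq, hd.inv_mul] using this
      · simp only [mul_inv_cancel_left, Prod.mk.injEq, and_true]
        conv_lhs => rw [← hz]
        simp only [extend]
        group
  calc (avoiding d (14 * ρ) b m).ncard * (m + 1)
      ≤ ((2 * (d 1 b + r) + 1) * V) * (bset d (m + (d 1 b + 2 * φ))).ncard := key
    _ ≤ (((2 * r + 2) * (d 1 b + 1)) * V) *
        ((bset d 1).ncard ^ (d 1 b + 2 * φ) * (bset d m).ncard) := by
        gcongr
        · nlinarith [Nat.zero_le (r * d 1 b)]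
        · exact hd.ncard_bset_add_le_pow _ _
    _ = _ := by rw [pow_add]; ring

/-- Bounded spheres would mean linear growth, but transversality makes the products `f ^ i * t * f ^
j` pairwise distinct, so growth is at least quadratic. -/
lemma IsGeodesicMetric.exists_ncard_sset_ge (hd : IsGeodesicMetric d)
    (hf : Function.Injective fun k : ℤ => f ^ k) {t : G} (ht : Transverse f t) (M : ℕ) :
    ∃ i, M ≤ (sset d i).ncard := by
  by_contra! h
  set L := 2 * d 1 f + d 1 t + 1 with hL
  have hpow : ∀ i : ℕ, d 1 (f ^ i) ≤ i * d 1 f := by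
    intro i
    induction i with
    | zero => simp [hd.self]
    | succ i ih =>
      rw [pow_succ, add_mul, one_mul]
      exact (hd.mul_le _ _).trans (by omega)
  have hupper : ∀ n, (bset d n).ncard ≤ (n + 1) * M := fun n => by
    rw [hd.ncard_bset_eq_sum]
    refine (Finset.sum_le_card_nsmul _ _ M fun i _ => (h i).le).trans ?_
    simp
  have hlower : ∀ n : ℕ, (n + 1) * (n + 1) ≤ (bset d (2 * n * d 1 f + d 1 t)).ncard := fun n => by
    have hcard : (Set.Iic n).ncard = n + 1 := by
      rw [← Finset.coe_Iic, Set.ncard_coe_finset, Nat.card_Iic]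
    rw [← hcard, ← Set.ncard_prod]
    refine Set.ncard_le_ncard_of_injOn (fun z : ℕ × ℕ => f ^ z.1 * t * f ^ z.2) ?_ ?_
      (hd.finite_bset _)
    · rintro ⟨i, j⟩ ⟨hi, hj⟩
      simp only [Set.mem_Iic] at hi hj
      have h1 := hd.mul_le (f ^ i * t) (f ^ j)
      have h2 := hd.mul_le (f ^ i) t
      have h3 := (hpow i).trans (Nat.mul_le_mul_right _ hi)
      have h4 := (hpow j).trans (Nat.mul_le_mul_right _ hj)
      have h5 : 2 * n * d 1 f = n * d 1 f + n * d 1 f := by ring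
      simp only [bset, Set.mem_ofPred_eq]
      omega
    · rintro ⟨i, j⟩ - ⟨k, l⟩ - he
      simp only at he
      have hik : i = k := by
        by_contra hne
        apply ht ((j : ℤ) - l) ((k : ℤ) - i) (by omega)
        rw [zpow_sub, zpow_sub, zpow_natCast, zpow_natCast, zpow_natCast, zpow_natCast]
        have : t * f ^ j = (f ^ i)⁻¹ * (f ^ k * t * f ^ l) := by rw [← he]; group
        rw [← mul_assoc, this, ← zpow_natCast, ← zpow_natCast, ← zpow_natCast]
        group
      subst hik
      have : f ^ j = f ^ l := by simpa using he
      have := hf (a₁ := (j : ℤ)) (a₂ := l) (by simpa using this)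
      simp only [Nat.cast_inj] at this
      rw [this]
  have h1 := (hlower (L * M)).trans (hupper _)
  have h2 : (2 * (L * M) * d 1 f + d 1 t + 1) * M ≤ (L * (L * M + 1)) * M := by
    gcongr
    rw [hL]
    nlinarith [Nat.zero_le (d 1 t * ((2 * d 1 f + d 1 t + 1) * M)),
      Nat.zero_le ((2 * d 1 f + d 1 t + 1) * M)]
  nlinarith

/-- A sphere with at least `2 * C` elements makes balls double whenever the radius grows by `l`.
Sums of ball sizes are then dominated by the last terms, so the estimate for spheres can be summed
over the radius. -/
lemma IsExtender.ncard_bset_mul_le (hs : IsExtender d f N ρ s) (hd : IsGeodesicMetric d)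
    (hf : Function.Injective fun k : ℤ => f ^ k) {t : G} (ht : Transverse f t) :
    ∃ C, 0 < C ∧ ∀ i j, (bset d i).ncard * (bset d j).ncard ≤ C * (bset d (i + j)).ncard := by
  obtain ⟨C, hC, hmul⟩ := hs.ncard_sset_mul_le hd
  obtain ⟨l, hl⟩ := hd.exists_ncard_sset_ge hf ht (2 * C)
  have hdouble : ∀ i, 2 * (bset d i).ncard ≤ (bset d (l + i)).ncard := fun i => by
    have := (Nat.mul_le_mul_right _ hl).trans (hmul l i)
    rw [mul_comm 2 C, mul_assoc] at this
    exact Nat.le_of_mul_le_mul_left this hC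
  -- By doubling, twice the sum is at most the sum shifted by `l`, which exceeds the original by at
  -- most its `l` last terms.
  have hsum : ∀ n, ∑ k ∈ Finset.range n, (bset d k).ncard ≤ l * (bset d (l + n)).ncard := by
    intro n
    have h1 : ∑ k ∈ Finset.range n, 2 * (bset d k).ncard ≤
        ∑ k ∈ Finset.range n, (bset d (l + k)).ncard := Finset.sum_le_sum fun k _ => hdouble k
    have h2 : ∑ k ∈ Finset.range (l + n), (bset d k).ncard =
        ∑ k ∈ Finset.range l, (bset d k).ncard + ∑ k ∈ Finset.range n, (bset d (l + k)).ncard :=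
      Finset.sum_range_add _ _ _
    have h3 : ∑ k ∈ Finset.range (n + l), (bset d k).ncard =
        ∑ k ∈ Finset.range n, (bset d k).ncard + ∑ k ∈ Finset.range l, (bset d (n + k)).ncard :=
      Finset.sum_range_add _ _ _
    have h4 : ∑ k ∈ Finset.range l, (bset d (n + k)).ncard ≤ l * (bset d (l + n)).ncard := by
      refine (Finset.sum_le_card_nsmul _ _ ((bset d (l + n)).ncard) fun k hk =>
        hd.ncard_bset_mono ?_).trans (by simp)
      have := Finset.mem_range.1 hk
      omega
    rw [← Finset.mul_sum] at h1
    rw [add_comm n l] at h3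
    omega
  refine ⟨C * (l + 1) * (bset d 1).ncard ^ (l + 1), ?_, fun i j => ?_⟩
  · have := hd.ncard_bset_pos 1
    positivity
  calc (bset d i).ncard * (bset d j).ncard
      = ∑ k ∈ Finset.range (i + 1), (sset d k).ncard * (bset d j).ncard := by
        rw [hd.ncard_bset_eq_sum i, Finset.sum_mul]
    _ ≤ ∑ k ∈ Finset.range (i + 1), C * (bset d (j + k)).ncard :=
        Finset.sum_le_sum fun k _ => by rw [add_comm j k]; exact hmul k j
    _ = C * ∑ k ∈ Finset.range (i + 1), (bset d (j + k)).ncard := by rw [Finset.mul_sum]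
    _ ≤ C * ∑ k ∈ Finset.range (j + (i + 1)), (bset d k).ncard := by
        rw [Finset.sum_range_add _ j (i + 1)]
        gcongr
        omega
    _ ≤ C * (l * (bset d (l + (j + (i + 1)))).ncard) := by gcongr; exact hsum _
    _ ≤ C * ((l + 1) * ((bset d 1).ncard ^ (l + 1) * (bset d (i + j)).ncard)) := by
        gcongr
        · omega
        · rw [show l + (j + (i + 1)) = i + j + (l + 1) by omega]
          exact hd.ncard_bset_add_le_pow _ _
    _ = _ := by ring

end Counting

/-! ### The word metric and its contracting elements -/

section WordMetric

variable {S : Set G}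

lemma mulCayley_connected (hS : Subgroup.closure S = ⊤) : (SimpleGraph.mulCayley S).Connected := by
  have hstep : ∀ x y : G, x⁻¹ * y ∈ S → (SimpleGraph.mulCayley S).Reachable x y := by
    intro x y h
    by_cases hxy : x = y
    · rw [hxy]
    · exact ((SimpleGraph.mulCayley_adj S x y).2 ⟨hxy, Or.inl h⟩).reachable
  have h1 : ∀ g : G, ∀ x : G, (SimpleGraph.mulCayley S).Reachable x (x * g) := by
    intro g
    have hg : g ∈ Subgroup.closure S := by rw [hS]; trivial
    induction hg using Subgroup.closure_induction with
    | mem y hy => exact fun x => hstep _ _ (by simpa using hy)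
    | one => intro x; simp
    | mul y z _ _ hy hz =>
      intro x
      rw [← mul_assoc]
      exact (hy x).trans (hz _)
    | inv y _ hy =>
      intro x
      simpa using (hy (x * y⁻¹)).symm
  refine (SimpleGraph.connected_iff _).2 ⟨fun x y => ?_, ⟨1⟩⟩
  simpa using h1 (x⁻¹ * y) x

lemma wordDist_mul_left (hS : Subgroup.closure S = ⊤) (g x y : G) :
    wordDist S (g * x) (g * y) = wordDist S x y := by
  have key : ∀ g x y : G, wordDist S (g * x) (g * y) ≤ wordDist S x y := by
    intro g x y
    obtain ⟨p, hp⟩ := (mulCayley_connected hS).exists_walk_length_eq_dist x y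
    let φ : SimpleGraph.mulCayley S →g SimpleGraph.mulCayley S :=
      ⟨fun x => g * x, fun h => SimpleGraph.mulCayley_adj_mul_iff_right.2 h⟩
    have := SimpleGraph.dist_le (p.map φ)
    rw [SimpleGraph.Walk.length_map, hp] at this
    exact this
  refine le_antisymm (key g x y) ?_
  simpa using key g⁻¹ (g * x) (g * y)

lemma exists_isGeod_wordDist (hS : Subgroup.closure S = ⊤) (x y : G) :
    ∃ c : ℕ → G, IsGeod (wordDist S) (wordDist S x y) c ∧ c 0 = x ∧ c (wordDist S x y) = y := by
  have hconn := mulCayley_connected hS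
  obtain ⟨p, hp⟩ := hconn.exists_walk_length_eq_dist x y
  have hend : p.getVert (wordDist S x y) = y := by
    rw [wordDist, ← hp]; simp
  refine ⟨p.getVert, ?_, by simp, hend⟩
  have hle : ∀ i k, i + k ≤ p.length → wordDist S (p.getVert i) (p.getVert (i + k)) ≤ k := by
    intro i k
    induction k with
    | zero => simp [wordDist]
    | succ k ih =>
      intro hk
      have h1 := ih (by omega)
      have h2 : wordDist S (p.getVert (i + k)) (p.getVert (i + k + 1)) = 1 :=
        SimpleGraph.dist_eq_one_iff_adj.2 (p.adj_getVert_succ (by omega))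
      have h3 : wordDist S (p.getVert i) (p.getVert (i + k + 1)) ≤ _ :=
        hconn.dist_triangle (v := p.getVert (i + k))
      unfold wordDist at *
      rw [← add_assoc]
      omega
  intro i j hij hj
  have hj : j ≤ p.length := by rw [hp]; exact hj
  have h1 := hle 0 i (by omega)
  have h2 := hle i (j - i) (by omega)
  have h3 := hle j (p.length - j) (by omega)
  have h4 : wordDist S x y ≤ _ := hconn.dist_triangle (v := p.getVert i)
  have h5 : wordDist S (p.getVert i) y ≤ _ := hconn.dist_triangle (v := p.getVert j)
  rw [show i + (j - i) = j by omega] at h2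
  rw [show j + (p.length - j) = p.length by omega, SimpleGraph.Walk.getVert_length] at h3
  rw [zero_add, SimpleGraph.Walk.getVert_zero] at h1
  unfold wordDist at *
  omega

lemma isGeodesicMetric_wordDist (hSfin : S.Finite) (hS : Subgroup.closure S = ⊤) :
    IsGeodesicMetric (wordDist S) where
  eq_zero_iff _ _ := (mulCayley_connected hS).dist_eq_zero_iff
  comm _ _ := SimpleGraph.dist_comm
  tri _ _ _ := (mulCayley_connected hS).dist_triangle
  left := wordDist_mul_left hS
  geod := exists_isGeod_wordDist hS
  finite n := by
    induction n with
    | zero =>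
      refine (Set.finite_singleton (1 : G)).subset fun g hg => ?_
      have : wordDist S 1 g = 0 := by simpa using hg
      exact ((mulCayley_connected hS).dist_eq_zero_iff.1 this).symm
    | succ n ih =>
      refine (ih.union (ih.mul (hSfin.union hSfin.inv))).subset fun g hg => ?_
      have hg : wordDist S 1 g ≤ n + 1 := hg
      by_cases h : wordDist S 1 g ≤ n
      · exact Or.inl h
      · right
        obtain ⟨c, hc, h0, h1⟩ := exists_isGeod_wordDist hS 1 g
        have hn : wordDist S 1 g = n + 1 := by omega
        rw [hn] at hc h1
        refine ⟨c n, ?_, (c n)⁻¹ * g, ?_, by simp⟩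
        · have := hc.dist_zero (i := n) (by omega)
          rw [h0] at this
          exact this.le
        · have := hc n (n + 1) (by omega) le_rfl
          rw [h1] at this
          have hadj := SimpleGraph.dist_eq_one_iff_adj.1 (show wordDist S (c n) g = 1 by omega)
          rw [SimpleGraph.mulCayley_adj] at hadj
          rcases hadj.2 with h | h
          · exact Or.inl h
          · exact Or.inr (by simpa using h)

lemma wordDist_le_diam {A : Set G} {x y : G} (hx : x ∈ A) (hy : y ∈ A) :
    (wordDist S x y : ℝ≥0∞) ≤ diam S A :=
  le_iSup₂_of_le x hx (le_iSup₂_of_le y hy le_rfl)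

lemma IsGeod.isGeodesic_image (hS : IsGeodesicMetric (wordDist S)) {n : ℕ} {c : ℕ → G}
    (hc : IsGeod (wordDist S) n c) {i j : ℕ} (hij : i ≤ j) (hj : j ≤ n) :
    IsGeodesic S (c '' Set.Icc i j) := by
  refine ⟨Set.Icc (i : ℤ) j, fun k => c k.toNat, ⟨⟨i, by simpa using hij⟩,
    Set.ordConnected_Icc, ?_⟩, ?_⟩
  · have key : ∀ a b : ℤ, (i : ℤ) ≤ a → a ≤ b → b ≤ j →
        (wordDist S (c a.toNat) (c b.toNat) : ℤ) = b - a := by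
      intro a b ha hab hb
      have := hc a.toNat b.toNat (by omega) (by omega)
      omega
    intro a ha b hb
    rcases le_total a b with h | h
    · rw [key a b ha.1 h hb.2, abs_sub_comm, abs_of_nonneg (by omega)]
    · rw [hS.comm, key b a hb.1 h ha.2, abs_of_nonneg (by omega)]
  · ext x
    constructor
    · rintro ⟨k, ⟨h1, h2⟩, rfl⟩
      exact ⟨k, ⟨by simpa using h1, by simpa using h2⟩, by simp⟩
    · rintro ⟨k, ⟨h1, h2⟩, rfl⟩
      exact ⟨k.toNat, ⟨by omega, by omega⟩, rfl⟩

/-- Cut the geodesic at its first and last times within `D'` of `γ`. The parts before and after stay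
far from `γ`, so each has projection of diameter at most `D'`. The one step between a far part and
the cutting time explains `2 * D' + 2`. -/
lemma contr_of_isContractingSet (hS : IsGeodesicMetric (wordDist S)) {D : ℝ} {γ : Set G}
    (hγ : γ.Nonempty) (hD : IsContractingSet S D γ) : ∃ E, Contr (wordDist S) E γ := by
  set D' := ⌈D⌉₊ with hD'
  have hDD : ENNReal.ofReal D ≤ (D' : ℝ≥0∞) := by
    rw [← ENNReal.ofReal_natCast]
    exact ENNReal.ofReal_le_ofReal (Nat.le_ceil D)
  have far : ∀ n c, IsGeod (wordDist S) n c → ∀ i j, i ≤ j → j ≤ n →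
      (∀ k, i ≤ k → k ≤ j → ∀ a ∈ γ, D' < wordDist S (c k) a) → ∀ p q,
      Nearest (wordDist S) γ (c i) p → Nearest (wordDist S) γ (c j) q → wordDist S p q ≤ D' := by
    intro n c hc i j hij hj hfar p q hp hq
    have h1 : ((D' + 1 : ℕ) : ℝ≥0∞) ≤ setDist S γ (c '' Set.Icc i j) := by
      refine le_iInf₂ fun a ha => le_iInf₂ ?_
      rintro _ ⟨k, ⟨hk1, hk2⟩, rfl⟩
      rw [hS.comm]
      exact_mod_cast hfar k hk1 hk2 a ha
    have h2 := hD _ (hc.isGeodesic_image hS hij hj)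
      (lt_of_lt_of_le (lt_of_le_of_lt hDD (by exact_mod_cast Nat.lt_succ_self D')) h1)
    have h3 : (wordDist S p q : ℝ≥0∞) ≤ diam S (proj S γ (c '' Set.Icc i j)) :=
      wordDist_le_diam ⟨hp.1, c i, ⟨i, ⟨le_rfl, hij⟩, rfl⟩, hp.2⟩
        ⟨hq.1, c j, ⟨j, ⟨hij, le_rfl⟩, rfl⟩, hq.2⟩
    exact_mod_cast (h3.trans h2.le).trans hDD
  refine ⟨2 * D' + 2, fun n c hc p q hp hq hpq => ?_⟩
  classical
  by_cases hmeet : ∃ k, k ≤ n ∧ ∃ a ∈ γ, wordDist S (c k) a ≤ D'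
  · obtain ⟨hi, a, ha, hia⟩ := Nat.find_spec hmeet
    set i := Nat.find hmeet with hidef
    have hmin : ∀ k < i, ∀ a ∈ γ, D' < wordDist S (c k) a := by
      intro k hk a ha
      by_contra! hcon
      exact Nat.find_min hmeet hk ⟨by omega, a, ha, hcon⟩
    set Q : ℕ → Prop := fun k => ∃ a ∈ γ, wordDist S (c k) a ≤ D' with hQ
    have hQi : Q i := ⟨a, ha, hia⟩
    set j := Nat.findGreatest Q n with hjdef
    have hij : i ≤ j := Nat.le_findGreatest hi hQi
    have hj : j ≤ n := Nat.findGreatest_le n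
    obtain ⟨a', ha', hja⟩ : Q j := Nat.findGreatest_spec hi hQi
    have hmax : ∀ k, j < k → k ≤ n → ∀ a ∈ γ, D' < wordDist S (c k) a := by
      intro k hk hkn a ha
      by_contra! hcon
      exact Nat.findGreatest_is_greatest hk hkn ⟨a, ha, hcon⟩
    refine ⟨i, j, hij, hj, ?_, ?_⟩
    · rcases Nat.eq_zero_or_pos i with h | h
      · rw [h] at hia ⊢
        have := hp.2 a ha
        omega
      · obtain ⟨p', hp'⟩ := exists_nearest (wordDist S) hγ (c (i - 1))
        have h1 := far n c hc 0 (i - 1) (by omega) (by omega)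
          (fun k _ hk => hmin k (by omega)) p p' hp hp'
        have h2 := hp'.2 a ha
        have h3 := hc (i - 1) i (by omega) hi
        have h4 := hS.tri (c (i - 1)) (c i) a
        have h5 := hS.tri (c i) (c (i - 1)) p
        have h6 := hS.tri (c (i - 1)) p' p
        have h7 := hS.comm (c i) (c (i - 1))
        have h8 := hS.comm p p'
        omega
    · rcases Nat.lt_or_ge j n with h | h
      · obtain ⟨q', hq'⟩ := exists_nearest (wordDist S) hγ (c (j + 1))
        have h1 := far n c hc (j + 1) n (by omega) le_rfl
          (fun k hk hk' => hmax k (by omega) hk') q' q hq' hq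
        have h2 := hq'.2 a' ha'
        have h3 := hc j (j + 1) (by omega) h
        have h4 := hS.tri (c (j + 1)) (c j) a'
        have h5 := hS.tri (c j) (c (j + 1)) q
        have h6 := hS.tri (c (j + 1)) q' q
        have h7 := hS.comm (c j) (c (j + 1))
        omega
      · have hjn : j = n := le_antisymm hj h
        rw [hjn] at hja ⊢
        have := hq.2 a' ha'
        omega
  · push Not at hmeet
    have := far n c hc 0 n (by omega) le_rfl (fun k _ hk a ha => hmeet k hk a ha) p q hp hq
    omega

/-- Nearest points on a contracting set and on a set close to it are close. -/
lemma IsGeodesicMetric.dist_nearest_of_close {d : G → G → ℕ} (hd : IsGeodesicMetric d) {E A : ℕ}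
    {γ P : Set G} (hγ : Contr d E γ) (h1 : ∀ x ∈ γ, ∃ y ∈ P, d x y ≤ A)
    (h2 : ∀ x ∈ P, ∃ y ∈ γ, d x y ≤ A) {y p a : G} (hp : Nearest d P y p) (ha : Nearest d γ y a) :
    d p a ≤ 3 * A + 4 * E := by
  obtain ⟨p', hp', hpp'⟩ := h2 p hp.1
  obtain ⟨a', ha', haa'⟩ := h1 a ha.1
  have i1 := hp.2 a' ha'
  have i2 := hd.tri y a a'
  have i3 := hd.tri y p p'
  have i4 := hd.tri p p' a
  have i5 := hd.comm p' a
  by_cases h : E < d a p'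
  · have := hd.dist_ge_of_nearest hγ ha (hd.nearest_self hp') h
    omega
  · omega

/-- Each projection moves by at most `3 * A + 4 * E` on replacing one set by the other; the constant
is twice this plus `E`. -/
lemma IsGeodesicMetric.contr_of_close {d : G → G → ℕ} (hd : IsGeodesicMetric d) {E A : ℕ}
    {γ P : Set G} (hγ : Contr d E γ) (h1 : ∀ x ∈ γ, ∃ y ∈ P, d x y ≤ A)
    (h2 : ∀ x ∈ P, ∃ y ∈ γ, d x y ≤ A) : Contr d (6 * A + 9 * E) P := by
  intro n c hc p q hp hq hpq
  obtain ⟨p', hp', -⟩ := h2 p hp.1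
  obtain ⟨a, ha⟩ := exists_nearest d ⟨p', hp'⟩ (c 0)
  obtain ⟨b, hb⟩ := exists_nearest d ⟨p', hp'⟩ (c n)
  have i1 := hd.dist_nearest_of_close hγ h1 h2 hp ha
  have i2 := hd.dist_nearest_of_close hγ h1 h2 hq hb
  have i3 := hd.tri p a q
  have i4 := hd.tri a b q
  have i5 := hd.comm b q
  obtain ⟨i, j, hij, hj, hi', hj'⟩ := hγ n c hc a b ha hb (by omega)
  have i6 := hd.tri (c i) a p
  have i7 := hd.tri (c j) b q
  have i8 := hd.comm a p
  exact ⟨i, j, hij, hj, by omega, by omega⟩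

lemma exists_of_subset_nbhd {A : ℝ} {X Y : Set G} (h : X ⊆ nbhd S A Y) {x : G} (hx : x ∈ X) :
    ∃ y ∈ Y, wordDist S x y ≤ ⌈A⌉₊ := by
  obtain ⟨y, hy, hxy⟩ := h hx
  exact ⟨y, hy, by exact_mod_cast hxy.trans (Nat.le_ceil A)⟩

/-- A contracting element has infinite order, its cyclic group is contracting, and sets from which
it is strongly independent have bounded projections to this group. -/
lemma IsContractingStronglyIndependent.exists_contr (hS : IsGeodesicMetric (wordDist S)) {f : G}
    {H : Set G} (h : IsContractingStronglyIndependent S f H) :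
    (Function.Injective fun k : ℤ => f ^ k) ∧ ∃ E C, Contr (wordDist S) E (axis f) ∧
      ∀ t : G, ∀ x ∈ t • H, ∀ y ∈ t • H, ∀ p q, Nearest (wordDist S) (axis f) x p →
        Nearest (wordDist S) (axis f) y q → wordDist S p q ≤ C := by
  obtain ⟨γ, ⟨-, hinf, A, hA1, hA2⟩, ⟨D, -, hD⟩, hsup⟩ := h
  obtain ⟨E, hE⟩ := contr_of_isContractingSet hS hinf.nonempty hD
  have h1 : ∀ x ∈ γ, ∃ y ∈ axis f, wordDist S x y ≤ ⌈A⌉₊ := fun x hx => exists_of_subset_nbhd hA1 hx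
  have h2 : ∀ x ∈ axis f, ∃ y ∈ γ, wordDist S x y ≤ ⌈A⌉₊ := fun x hx => exists_of_subset_nbhd hA2 hx
  obtain ⟨M, hM⟩ := ENNReal.exists_nat_gt hsup.ne
  refine ⟨?_, _, M + 2 * (3 * ⌈A⌉₊ + 4 * E), hS.contr_of_close hE h1 h2, ?_⟩
  -- If `f` had finite order, `γ` would lie in a bounded neighbourhood of a finite set and be
  -- finite.
  · rw [injective_zpow_iff_not_isOfFinOrder]
    intro hfin
    have haxis : (axis f).Finite := hfin.finite_zpowers
    refine hinf ((haxis.biUnion fun y _ => (hS.finite ⌈A⌉₊).smul_set (a := y)).subset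
      fun x hx => ?_)
    obtain ⟨y, hy, hxy⟩ := h1 x hx
    refine Set.mem_biUnion hy ⟨y⁻¹ * x, ?_, by simp⟩
    simpa [hS.inv_mul, hS.comm y x] using hxy
  · intro t x hx y hy p q hp hq
    obtain ⟨a, ha⟩ := exists_nearest (wordDist S) hinf.nonempty x
    obtain ⟨b, hb⟩ := exists_nearest (wordDist S) hinf.nonempty y
    have i1 := hS.dist_nearest_of_close hE h1 h2 hp ha
    have i2 := hS.dist_nearest_of_close hE h1 h2 hq hb
    have i3 := hS.tri p a q
    have i4 := hS.tri a b q
    have i5 := hS.comm b q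
    have i6 : (wordDist S a b : ℝ≥0∞) ≤ M :=
      (wordDist_le_diam (A := proj S γ (t • H)) ⟨ha.1, x, hx, ha.2⟩ ⟨hb.1, y, hy, hb.2⟩).trans
        ((le_iSup (fun t : G => diam S (proj S γ (t • H))) t).trans hM.le)
    have i7 : wordDist S a b ≤ M := by exact_mod_cast i6
    omega

end WordMetric

/-! ### Excursions and avoidance -/

section Inclusions

variable {S : Set G}

lemma IsGeod.isGeodesicFromTo (hS : IsGeodesicMetric (wordDist S)) {n : ℕ} {c : ℕ → G}
    (hc : IsGeod (wordDist S) n c) : IsGeodesicFromTo S (c 0) (c n) (c '' Set.Iic n) := by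
  refine ⟨n, fun k => c k.toNat, ⟨⟨0, by simp⟩, Set.ordConnected_Icc, ?_⟩, by simp, by simp, ?_⟩
  · have key : ∀ a b : ℤ, 0 ≤ a → a ≤ b → b ≤ n →
        (wordDist S (c a.toNat) (c b.toNat) : ℤ) = b - a := by
      intro a b ha hab hb
      have := hc a.toNat b.toNat (by omega) (by omega)
      omega
    intro a ha b hb
    rcases le_total a b with h | h
    · rw [key a b ha.1 h hb.2, abs_sub_comm, abs_of_nonneg (by omega)]
    · rw [hS.comm, key b a hb.1 h ha.2, abs_of_nonneg (by omega)]
  · ext x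
    constructor
    · rintro ⟨k, h, rfl⟩
      exact ⟨k, ⟨by simp, by simpa using h⟩, by simp⟩
    · rintro ⟨k, ⟨h1, h2⟩, rfl⟩
      exact ⟨k.toNat, by simp only [Set.mem_Iic]; omega, rfl⟩

lemma IsGeodesicFromTo.exists_isGeod {x y : G} {γ : Set G} (h : IsGeodesicFromTo S x y γ) :
    ∃ n c, IsGeod (wordDist S) n c ∧ c 0 = x ∧ c n = y ∧ γ = c '' Set.Iic n := by
  obtain ⟨n, c, ⟨-, -, hc⟩, h0, hn, rfl⟩ := h
  refine ⟨n, fun k => c k, fun i j hij hj => ?_, by simpa using h0, hn, ?_⟩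
  · have := hc i ⟨by omega, by omega⟩ j ⟨by omega, by omega⟩
    rw [abs_sub_comm, abs_of_nonneg (by omega)] at this
    simp only
    omega
  · ext x
    constructor
    · rintro ⟨k, ⟨h1, h2⟩, rfl⟩
      exact ⟨k.toNat, by simp only [Set.mem_Iic]; omega, by simp [h1]⟩
    · rintro ⟨k, h, rfl⟩
      exact ⟨k, ⟨by simp, by simpa using h⟩, rfl⟩

/-- A coarsely geodesically connected set of infinite diameter is coarsely joined by segments of
every length. -/
lemma exists_segment (hS : IsGeodesicMetric (wordDist S)) {H : Set G} {R : ℝ}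
    (hH : ∀ x ∈ H, ∀ y ∈ H, ∃ γ : Set G, IsGeodesicFromTo S x y γ ∧ γ ⊆ nbhd S R H)
    (hdiam : diam S H = ⊤) (l : ℕ) :
    ∃ x b, wordDist S 1 b = l ∧ x ∈ nbhd S R H ∧ x * b ∈ nbhd S R H := by
  obtain ⟨x, hx, y, hy, hxy⟩ : ∃ x ∈ H, ∃ y ∈ H, l < wordDist S x y := by
    by_contra! hcon
    have : diam S H ≤ l := iSup₂_le fun x hx => iSup₂_le fun y hy => by
      exact_mod_cast hcon x hx y hy
    rw [hdiam] at this
    simp at this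
  obtain ⟨γ, hγ, hsub⟩ := hH x hx y hy
  obtain ⟨n, c, hc, h0, hn, rfl⟩ := hγ.exists_isGeod
  have hn' := hc.dist_zero le_rfl
  rw [h0, hn] at hn'
  refine ⟨c 0, (c 0)⁻¹ * c l, ?_, hsub ⟨0, by simp, rfl⟩,
    hsub ⟨l, by simp only [Set.mem_Iic]; omega, by simp⟩⟩
  rw [hS.inv_mul, hc.dist_zero (by omega)]

/-- If a geodesic from `1` to `g` passes near both ends of a copy of a segment between points near
`H`, then the excursion of `g` into `H` is long. -/
lemma le_excursion (hS : IsGeodesicMetric (wordDist S)) {H : Set G} {R : ℝ} {x₀ b : G}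
    (h0 : x₀ ∈ nbhd S R H) (h1 : x₀ * b ∈ nbhd S R H) {m r : ℕ} {c : ℕ → G}
    (hc : IsGeod (wordDist S) m c) (hc0 : c 0 = 1) {x : G} {i j : ℕ} (hi : i ≤ m) (hj : j ≤ m)
    (hix : wordDist S (c i) x ≤ r) (hjx : wordDist S (c j) (x * b) ≤ r) :
    ((wordDist S 1 b - 2 * r : ℕ) : ℝ≥0∞) ≤ excursion S H (R + r) (c m) := by
  have hmem : ∀ u y, y ∈ nbhd S R H → wordDist S u (x * x₀⁻¹ * y) ≤ r →
      u ∈ nbhd S (R + r) ((x * x₀⁻¹) • H) := by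
    -- Translation by `x * x₀⁻¹` carries the model segment from `x₀` to `x₀ * b` onto the one from
    -- `x` to `x * b`.
    rintro u y ⟨h, hh, hyh⟩ hu
    refine ⟨x * x₀⁻¹ * h, Set.smul_mem_smul_set (a := x * x₀⁻¹) hh, ?_⟩
    have t1 := hS.tri u (x * x₀⁻¹ * y) (x * x₀⁻¹ * h)
    rw [hS.left] at t1
    have t2 : (wordDist S u (x * x₀⁻¹ * h) : ℝ) ≤ r + wordDist S y h := by
      exact_mod_cast t1.trans (by omega)
    linarith
  have m1 : c i ∈ nbhd S (R + r) ((x * x₀⁻¹) • H) := hmem _ x₀ h0 (by simpa using hix)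
  have m2 : c j ∈ nbhd S (R + r) ((x * x₀⁻¹) • H) := hmem _ _ h1 (by simpa [mul_assoc] using hjx)
  have hgeo := hc.isGeodesicFromTo hS
  rw [hc0] at hgeo
  have hle : wordDist S 1 b - 2 * r ≤ wordDist S (c i) (c j) := by
    have := hS.tri x (c i) (x * b)
    have := hS.tri (c i) (c j) (x * b)
    have := hS.comm x (c i)
    have := hS.mul_right x b
    omega
  calc ((wordDist S 1 b - 2 * r : ℕ) : ℝ≥0∞) ≤ wordDist S (c i) (c j) := by exact_mod_cast hle
    _ ≤ diam S (c '' Set.Iic m ∩ nbhd S (R + r) ((x * x₀⁻¹) • H)) :=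
        wordDist_le_diam ⟨⟨i, hi, rfl⟩, m1⟩ ⟨⟨j, hj, rfl⟩, m2⟩
    _ ≤ geodesicExcursion S H (R + r) (c '' Set.Iic m) :=
        le_iSup (fun t : G => diam S (c '' Set.Iic m ∩ nbhd S (R + r) (t • H))) (x * x₀⁻¹)
    _ ≤ excursion S H (R + r) (c m) :=
        le_iSup₂_of_le (f := fun (γ : Set G) (_ : IsGeodesicFromTo S 1 (c m) γ) =>
          geodesicExcursion S H (R + r) γ) _ hgeo le_rfl

/-- Elements with a small excursion into `H` avoid long segments near `H`. -/
lemma mem_avoiding_of_excursion_lt (hS : IsGeodesicMetric (wordDist S)) {H : Set G} {R : ℝ}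
    {x₀ b : G} (h0 : x₀ ∈ nbhd S R H) (h1 : x₀ * b ∈ nbhd S R H) {r : ℕ} {g : G}
    (hg : excursion S H (R + r) g < ((wordDist S 1 b - 2 * r : ℕ) : ℝ≥0∞)) :
    g ∈ avoiding (wordDist S) r b (wordDist S 1 g) := by
  obtain ⟨c, hc, hc0, hc1⟩ := hS.geod 1 g
  refine ⟨c, hc, hc0, hc1, fun x i hi j hj ⟨h2, h3⟩ => ?_⟩
  have := le_excursion hS h0 h1 hc hc0 hi hj h2 h3
  rw [hc1] at this
  exact absurd hg (not_lt.2 this)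

/-- Geodesics between points near a translate of `H` avoid a large power of an element with bounded
projections of translates of `H`. -/
lemma exists_avoiding_of_independent {d : G → G → ℕ} (hd : IsGeodesicMetric d) {f : G} {E C : ℕ}
    (hf : Function.Injective fun k : ℤ => f ^ k) (hE : Contr d E (axis f)) {H : Set G}
    (hH : ∀ t : G, ∀ x ∈ t • H, ∀ y ∈ t • H, ∀ p q, Nearest d (axis f) x p →
        Nearest d (axis f) y q → d p q ≤ C) (K r : ℕ) :
    ∃ M : ℤ, ∀ n c, IsGeod d n c → ∀ t : G, (∃ h ∈ t • H, d (c 0) h ≤ K) →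
      (∃ h ∈ t • H, d (c n) h ≤ K) → ∀ x, ∀ i ≤ n, ∀ j ≤ n,
        ¬ (d (c i) x ≤ r ∧ d (c j) (x * f ^ M) ≤ r) := by
  set k := C + 2 * (K + 2 * E) with hk
  -- On any translate of the axis the endpoints project `k`-close to each other, so near visits of
  -- the geodesic stay within `3 * E + k + 2 * r` of the projection `p`. Visits near both `x` and `x
  -- * f ^ M` are excluded once the power is longer than twice this.
  obtain ⟨M, hM⟩ := hd.exists_zpow_gt hf (2 * (3 * E + k + 2 * r))
  refine ⟨M, ?_⟩
  rintro n c hc t ⟨y, hy, hyK⟩ ⟨y', hy', hyK'⟩ x i hi j hj ⟨hix, hjx⟩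
  have hx := hd.contr_smul hE x
  have hne := smul_axis_nonempty x f
  obtain ⟨p, hp⟩ := exists_nearest d hne (c 0)
  obtain ⟨q, hq⟩ := exists_nearest d hne (c n)
  obtain ⟨p', hp'⟩ := exists_nearest d hne y
  obtain ⟨q', hq'⟩ := exists_nearest d hne y'
  have hmem : ∀ z ∈ t • H, x⁻¹ * z ∈ (x⁻¹ * t) • H := by
    intro z hz
    rw [mul_smul]
    exact Set.smul_mem_smul_set (a := x⁻¹) hz
  have h1 := hH (x⁻¹ * t) _ (hmem y hy) _ (hmem y' hy') _ _ (hd.nearest_inv_mul x hp')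
    (hd.nearest_inv_mul x hq')
  rw [hd.left] at h1
  have h2 := hd.dist_nearest_le hx hp hp'
  have h3 := hd.dist_nearest_le hx hq hq'
  have hpq : d p q ≤ k := by
    have := hd.tri p p' q
    have := hd.tri p' q' q
    have := hd.comm q q'
    omega
  have h4 := hd.dist_le_of_near hx hc hp hq hpq (x := x) ⟨1, one_mem_axis f, by simp⟩ hi hix
  have h5 := hd.dist_le_of_near hx hc hp hq hpq (x := x * f ^ M) ⟨f ^ M, ⟨M, rfl⟩, rfl⟩ hj hjx
  have := hd.tri x p (x * f ^ M)
  have := hd.comm x p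
  have := hd.mul_right x (f ^ M)
  omega

end Inclusions

/-! ### Multiplying the estimates over pieces of a geodesic -/

section Estimates

variable {d : G → G → ℕ}

lemma IsGeodesicMetric.succ_le_ncard_bset (hd : IsGeodesicMetric d) {f : G}
    (hf : Function.Injective fun k : ℤ => f ^ k) (n : ℕ) : n + 1 ≤ (bset d n).ncard := by
  rw [hd.ncard_bset_eq_sum]
  calc n + 1 = ∑ i ∈ Finset.range (n + 1), 1 := by simp
    _ ≤ _ := Finset.sum_le_sum fun i _ => by
      obtain ⟨m, hm⟩ := hd.exists_zpow_gt hf i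
      obtain ⟨c, hc, h0, -⟩ := hd.geod 1 (f ^ m)
      rw [Nat.one_le_iff_ne_zero, ← Nat.pos_iff_ne_zero, Set.ncard_pos (hd.finite_sset i)]
      refine ⟨c i, ?_⟩
      have := hc.dist_zero hm.le
      rwa [h0] at this

variable {C : ℕ}

lemma ncard_bset_pow_mul_le
    (hC : ∀ i j, (bset d i).ncard * (bset d j).ncard ≤ C * (bset d (i + j)).ncard) (m j k : ℕ) :
    (bset d m).ncard ^ k * (bset d j).ncard ≤ C ^ k * (bset d (k * m + j)).ncard := by
  induction k with
  | zero => simp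
  | succ k ih =>
    calc (bset d m).ncard ^ (k + 1) * (bset d j).ncard
        = (bset d m).ncard * ((bset d m).ncard ^ k * (bset d j).ncard) := by ring
      _ ≤ (bset d m).ncard * (C ^ k * (bset d (k * m + j)).ncard) := by gcongr
      _ = C ^ k * ((bset d m).ncard * (bset d (k * m + j)).ncard) := by ring
      _ ≤ C ^ k * (C * (bset d (m + (k * m + j))).ncard) := Nat.mul_le_mul_left _ (hC _ _)
      _ = _ := by rw [show m + (k * m + j) = (k + 1) * m + j by ring]; ring

/-- The number of elements avoiding `b` in a ball, by cutting geodesics into `k` pieces. -/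
lemma IsGeodesicMetric.ncard_ball_avoiding_le (hd : IsGeodesicMetric d) {R X : ℕ} {b : G}
    (hC : ∀ i j, (bset d i).ncard * (bset d j).ncard ≤ C * (bset d (i + j)).ncard) {m k n : ℕ}
    (hgrow : m + 1 ≤ (bset d m).ncard)
    (hX : (avoiding d R b m).ncard * (m + 1) ≤ X * (bset d m).ncard) (hn : 2 * (k * m) ≤ n) :
    {g ∈ bset d n | g ∈ avoiding d R b (d 1 g)}.ncard * (m + 1) ^ k ≤
      C ^ k * (1 + X ^ k) * (bset d n).ncard := by
  set β := (bset d (n - k * m)).ncard with hβ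
  have hpow : (bset d m).ncard ^ k * β ≤ C ^ k * (bset d n).ncard := by
    have := ncard_bset_pow_mul_le hC m (n - k * m) k
    rwa [show k * m + (n - k * m) = n by omega] at this
  -- The first `k * m` letters consist of `k` avoiding pieces. Elements too short for this lie in
  -- the ball of radius `n - k * m` because `2 * (k * m) ≤ n`; `hgrow` makes them negligible.
  have hsub : {g ∈ bset d n | g ∈ avoiding d R b (d 1 g)} ⊆
      bset d (n - k * m) ∪ avoiding d R b (k * m) * bset d (n - k * m) := by
    rintro g ⟨hg, hav⟩
    have hg : d 1 g ≤ n := hg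
    rcases Nat.lt_or_ge (d 1 g) (k * m) with h | h
    · exact Or.inl (by simp only [bset, Set.mem_ofPred_eq]; omega)
    · right
      rw [show d 1 g = k * m + (d 1 g - k * m) by omega] at hav
      obtain ⟨u, hu, v, hv, rfl⟩ := hd.avoiding_add_subset R b _ _ hav
      refine ⟨u, hu, v, ?_, rfl⟩
      have : d 1 v = _ := avoiding_subset_sset d R b _ hv
      simp only [bset, Set.mem_ofPred_eq] at hg h this ⊢
      omega
  have hfin := (hd.finite_avoiding R b (k * m)).mul (hd.finite_bset (n - k * m))
  have h1 : {g ∈ bset d n | g ∈ avoiding d R b (d 1 g)}.ncard ≤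
      β + (avoiding d R b m).ncard ^ k * β := by
    refine (Set.ncard_le_ncard hsub ((hd.finite_bset _).union hfin)).trans
      ((Set.ncard_union_le _ _).trans ?_)
    gcongr
    refine (ncard_mul_le (hd.finite_avoiding ..) (hd.finite_bset _)).trans ?_
    gcongr
    exact hd.ncard_avoiding_mul_le R b m k
  calc {g ∈ bset d n | g ∈ avoiding d R b (d 1 g)}.ncard * (m + 1) ^ k
      ≤ (β + (avoiding d R b m).ncard ^ k * β) * (m + 1) ^ k := by gcongr
    _ = (m + 1) ^ k * β + ((avoiding d R b m).ncard * (m + 1)) ^ k * β := by rw [mul_pow]; ring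
    _ ≤ (bset d m).ncard ^ k * β + (X * (bset d m).ncard) ^ k * β := by gcongr
    _ = (1 + X ^ k) * ((bset d m).ncard ^ k * β) := by rw [mul_pow]; ring
    _ ≤ (1 + X ^ k) * (C ^ k * (bset d n).ncard) := by gcongr
    _ = _ := by ring

/-- Elements avoiding a fixed element are exponentially rare. -/
lemma IsGeodesicMetric.exists_two_pow_mul_ncard_avoiding_le (hd : IsGeodesicMetric d) {R X : ℕ}
    {b : G} (hC : ∀ i j, (bset d i).ncard * (bset d j).ncard ≤ C * (bset d (i + j)).ncard)
    (hX : ∀ m, (avoiding d R b m).ncard * (m + 1) ≤ X * (bset d m).ncard) :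
    ∃ m, 0 < m ∧ ∀ L, 2 ^ (L / m) * (avoiding d R b L).ncard ≤ (bset d L).ncard := by
  -- At length `m = 2 * Y` each piece costs a factor `X * C / (m + 1)`, which is less than `1/2`.
  set Y := (X + 1) * (C + 1) with hY
  have hYpos : 0 < Y := by positivity
  refine ⟨2 * Y, by omega, fun L => ?_⟩
  set m := 2 * Y with hm
  set k := L / m with hk
  have hL : k * m + L % m = L := Nat.div_add_mod' L m
  have h1 : (avoiding d R b L).ncard ≤ (avoiding d R b m).ncard ^ k * (bset d (L % m)).ncard := by
    have hsub := hd.avoiding_add_subset R b (k * m) (L % m)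
    rw [hL] at hsub
    refine (Set.ncard_le_ncard hsub ((hd.finite_avoiding ..).mul (hd.finite_avoiding ..))).trans
      ((ncard_mul_le (hd.finite_avoiding ..) (hd.finite_avoiding ..)).trans ?_)
    gcongr
    · exact hd.ncard_avoiding_mul_le R b m k
    · exact hd.finite_bset _
    · exact (avoiding_subset_sset ..).trans (sset_subset_bset ..)
  have h2 : (m + 1) ^ k * (avoiding d R b L).ncard ≤ Y ^ k * (bset d L).ncard := by
    calc (m + 1) ^ k * (avoiding d R b L).ncard
        ≤ (m + 1) ^ k * ((avoiding d R b m).ncard ^ k * (bset d (L % m)).ncard) := by gcongr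
      _ = ((avoiding d R b m).ncard * (m + 1)) ^ k * (bset d (L % m)).ncard := by
          rw [mul_pow]; ring
      _ ≤ (X * (bset d m).ncard) ^ k * (bset d (L % m)).ncard :=
          Nat.mul_le_mul_right _ (Nat.pow_le_pow_left (hX m) k)
      _ = X ^ k * ((bset d m).ncard ^ k * (bset d (L % m)).ncard) := by rw [mul_pow]; ring
      _ ≤ X ^ k * (C ^ k * (bset d L).ncard) := by
          have := ncard_bset_pow_mul_le hC m (L % m) k
          rw [hL] at this
          exact Nat.mul_le_mul_left _ this
      _ = (X * C) ^ k * (bset d L).ncard := by rw [mul_pow]; ring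
      _ ≤ Y ^ k * (bset d L).ncard := by
          gcongr
          exact Nat.mul_le_mul (by omega) (by omega)
  refine le_of_mul_le_mul_left (a := Y ^ k) ?_ (by positivity)
  calc Y ^ k * (2 ^ k * (avoiding d R b L).ncard) = m ^ k * (avoiding d R b L).ncard := by
        rw [show m ^ k = 2 ^ k * Y ^ k from mul_pow 2 Y k, ← mul_assoc, mul_comm (Y ^ k) (2 ^ k)]
    _ ≤ (m + 1) ^ k * (avoiding d R b L).ncard := by gcongr; omega
    _ ≤ _ := h2

/-- The number of elements of a ball with a geodesic containing a segment of length `L` that avoids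
`b`. -/
lemma IsGeodesicMetric.ncard_ball_mul_le (hd : IsGeodesicMetric d) {R : ℕ} {b : G}
    (hC : ∀ i j, (bset d i).ncard * (bset d j).ncard ≤ C * (bset d (i + j)).ncard) {m : ℕ}
    (hm : ∀ L, 2 ^ (L / m) * (avoiding d R b L).ncard ≤ (bset d L).ncard) (n L : ℕ) {B : Set G}
    (hB : ∀ g ∈ B, ∃ i, i + L ≤ n ∧ g ∈ bset d i * avoiding d R b L * bset d (n - i - L)) :
    2 ^ (L / m) * B.ncard ≤ (n + 1) * (C * C * (bset d n).ncard) := by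
  set T : ℕ → Set G := fun i => bset d i * avoiding d R b L * bset d (n - i - L) with hT
  have hfin : ∀ i, (T i).Finite := fun i =>
    ((hd.finite_bset i).mul (hd.finite_avoiding ..)).mul (hd.finite_bset _)
  set I := (Finset.range (n + 1)).filter fun i => i + L ≤ n with hI
  have hsub : B ⊆ ⋃ i ∈ I, T i := by
    intro g hg
    obtain ⟨i, hi, hgi⟩ := hB g hg
    exact Set.mem_biUnion (by simp [hI]; omega) hgi
  have h1 : B.ncard ≤ ∑ i ∈ I, (T i).ncard :=
    (Set.ncard_le_ncard hsub (I.finite_toSet.biUnion fun i _ => hfin i)).trans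
      (Finset.set_ncard_biUnion_le I T)
  have h2 : ∀ i ∈ I, 2 ^ (L / m) * (T i).ncard ≤ C * C * (bset d n).ncard := by
    intro i hi
    have hi : i + L ≤ n := (Finset.mem_filter.1 hi).2
    calc 2 ^ (L / m) * (T i).ncard
        ≤ 2 ^ (L / m) * ((bset d i).ncard * (avoiding d R b L).ncard *
            (bset d (n - i - L)).ncard) := by
          gcongr
          refine (ncard_mul_le ((hd.finite_bset i).mul (hd.finite_avoiding ..))
            (hd.finite_bset _)).trans ?_
          gcongr
          exact ncard_mul_le (hd.finite_bset i) (hd.finite_avoiding ..)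
      _ = (bset d i).ncard * (2 ^ (L / m) * (avoiding d R b L).ncard) *
            (bset d (n - i - L)).ncard := by ring
      _ ≤ (bset d i).ncard * (bset d L).ncard * (bset d (n - i - L)).ncard := by
          gcongr; exact hm L
      _ ≤ C * (bset d (i + L)).ncard * (bset d (n - i - L)).ncard :=
          Nat.mul_le_mul_right _ (hC _ _)
      _ = C * ((bset d (i + L)).ncard * (bset d (n - i - L)).ncard) := by ring
      _ ≤ C * (C * (bset d (i + L + (n - i - L))).ncard) := Nat.mul_le_mul_left _ (hC _ _)
      _ = _ := by rw [show i + L + (n - i - L) = n by omega]; ring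
  calc 2 ^ (L / m) * B.ncard ≤ 2 ^ (L / m) * ∑ i ∈ I, (T i).ncard := by gcongr
    _ = ∑ i ∈ I, 2 ^ (L / m) * (T i).ncard := Finset.mul_sum ..
    _ ≤ I.card • (C * C * (bset d n).ncard) := Finset.sum_le_card_nsmul _ _ _ h2
    _ ≤ (n + 1) * (C * C * (bset d n).ncard) := by
        rw [smul_eq_mul]
        gcongr
        exact (Finset.card_filter_le _ _).trans (by simp)

end Estimates

/-! ### Rates in terms of the radius -/

section Asymptotics

/-- The bound for small excursions, in terms of the radius `n`. -/
lemma exists_lower_rate (C X q r : ℕ) (hq : 1 ≤ q) (p : ℝ) : ∃ c : ℝ, 0 < c ∧ ∃ k : ℕ, ∃ A : ℝ,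
    ∀ n : ℕ, 1 ≤ n → ∀ l : ℕ, l = ⌈c * Real.log n⌉₊ + r → ∀ x β : ℝ, 0 ≤ β →
      x * ((n / (2 * k) : ℕ) + 1 : ℝ) ^ k ≤
        (C : ℝ) ^ k * (1 + ((X * (l + 1) * q ^ l : ℕ) : ℝ) ^ k) * β →
      x ≤ A * (n : ℝ) ^ (-p) * β := by
  -- The factor `2` absorbs `l + 1 ≤ 2 ^ l`. The choice of `c` below gives `Q ^ (c log n) = n ^
  -- (1/2)`, and `k ≥ 2p` gives `n ^ (-k/2) ≤ n ^ (-p)`.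
  set Q : ℝ := 2 * q with hQ
  have hq' : (1 : ℝ) ≤ q := by exact_mod_cast hq
  have hQ1 : 1 < Q := by linarith
  have hlogQ : 0 < Real.log Q := Real.log_pos hQ1
  set c := 1 / (2 * Real.log Q) with hc
  have hcpos : 0 < c := by positivity
  set k := ⌈2 * p⌉₊ + 1 with hk
  set Y : ℝ := X * Q ^ (r + 1) with hY
  have hY0 : 0 ≤ Y := by positivity
  refine ⟨c, hcpos, k, (C : ℝ) ^ k * (1 + Y ^ k) * (2 * k) ^ k, ?_⟩
  intro n hn l hl x β hβ hx
  have hn1 : (1 : ℝ) ≤ n := by exact_mod_cast hn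
  have hn0 : (0 : ℝ) < n := by linarith
  set w := (n : ℝ) ^ (1 / 2 : ℝ) with hw
  have hw1 : 1 ≤ w := Real.one_le_rpow hn1 (by norm_num)
  have hww : w * w = n := by
    rw [hw, ← Real.rpow_add hn0]; norm_num
  -- the size of the inserted segment
  have hQl : Q ^ l ≤ Q ^ (r + 1) * w := by
    have h1 : (⌈c * Real.log n⌉₊ : ℝ) ≤ c * Real.log n + 1 :=
      (Nat.ceil_lt_add_one (mul_nonneg hcpos.le (Real.log_nonneg hn1))).le
    have h2 : Q ^ (c * Real.log n) = w := by
      rw [Real.rpow_def_of_pos (by linarith), hw, Real.rpow_def_of_pos hn0, hc]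
      congr 1
      field_simp
    calc Q ^ l = Q ^ (⌈c * Real.log n⌉₊ : ℝ) * Q ^ r := by rw [hl, pow_add, Real.rpow_natCast]
      _ ≤ Q ^ (c * Real.log n + 1) * Q ^ r := by
          gcongr
          exact hQ1.le
      _ = _ := by rw [Real.rpow_add (by linarith), h2, Real.rpow_one, pow_succ]; ring
  have hXl : ((X * (l + 1) * q ^ l : ℕ) : ℝ) ≤ Y * w := by
    have h3 : ((l + 1 : ℕ) : ℝ) ≤ 2 ^ l := by exact_mod_cast (Nat.lt_two_pow_self : l < 2 ^ l)
    calc ((X * (l + 1) * q ^ l : ℕ) : ℝ) = X * (((l + 1 : ℕ) : ℝ) * q ^ l) := by push_cast; ring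
      _ ≤ X * (2 ^ l * q ^ l) := by gcongr
      _ = X * Q ^ l := by rw [hQ, mul_pow]
      _ ≤ X * (Q ^ (r + 1) * w) := by gcongr
      _ = _ := by rw [hY]; ring
  -- the number of positions
  have hkpos : (0 : ℝ) < 2 * k := by rw [hk]; positivity
  have hm : (n : ℝ) ≤ 2 * k * ((n / (2 * k) : ℕ) + 1 : ℝ) := by
    have : n < 2 * k * (n / (2 * k) + 1) := Nat.lt_mul_div_succ n (by omega)
    exact_mod_cast this.le
  set m1 : ℝ := ((n / (2 * k) : ℕ) + 1 : ℝ) with hm1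
  have hm1pos : 0 < m1 := by positivity
  have hmain : x * m1 ^ k ≤ (C : ℝ) ^ k * (1 + Y ^ k) * w ^ k * β := by
    refine hx.trans ?_
    have h4 : 1 + ((X * (l + 1) * q ^ l : ℕ) : ℝ) ^ k ≤ (1 + Y ^ k) * w ^ k := by
      have h5 : ((X * (l + 1) * q ^ l : ℕ) : ℝ) ^ k ≤ Y ^ k * w ^ k := by
        rw [← mul_pow]; gcongr
      have h6 : 1 ≤ w ^ k := one_le_pow₀ hw1
      linarith
    calc _ ≤ (C : ℝ) ^ k * ((1 + Y ^ k) * w ^ k) * β := by gcongr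
      _ = _ := by ring
  have hrate : w ^ k ≤ (n : ℝ) ^ (-p) * (n : ℝ) ^ k := by
    have e1 : (n : ℝ) ^ k = w ^ k * w ^ k := by rw [← hww, mul_pow]
    have e2 : 1 ≤ (n : ℝ) ^ (-p) * w ^ k := by
      rw [hw, ← Real.rpow_natCast, ← Real.rpow_mul hn0.le, ← Real.rpow_add hn0]
      refine Real.one_le_rpow hn1 ?_
      have : 2 * p ≤ ⌈2 * p⌉₊ := Nat.le_ceil _
      rw [hk]
      push_cast
      linarith
    rw [e1, ← mul_assoc]
    exact le_mul_of_one_le_left (by positivity) e2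
  have hpk : (n : ℝ) ^ k ≤ (2 * k) ^ k * m1 ^ k := by
    rw [← mul_pow]; gcongr
  refine le_of_mul_le_mul_right ?_ (pow_pos hm1pos k)
  calc x * m1 ^ k ≤ (C : ℝ) ^ k * (1 + Y ^ k) * w ^ k * β := hmain
    _ ≤ (C : ℝ) ^ k * (1 + Y ^ k) * ((n : ℝ) ^ (-p) * ((2 * k) ^ k * m1 ^ k)) * β := by
        gcongr
        exact hrate.trans (by gcongr)
    _ = _ := by ring

/-- The bound for large excursions, in terms of the radius `n`. -/
lemma exists_upper_rate (C m : ℕ) (hm : 0 < m) (p : ℝ) : ∃ c : ℝ, ∃ A : ℝ,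
    ∀ n : ℕ, 1 ≤ n → ∀ L : ℕ, L = ⌈c * Real.log n⌉₊ → ∀ x β : ℝ, 0 ≤ β →
      2 ^ (L / m) * x ≤ (n + 1) * (C * C * β) → x ≤ A * (n : ℝ) ^ (-p) * β := by
  have hlog2 : 0 < Real.log 2 := Real.log_pos (by norm_num)
  have hm' : (0 : ℝ) < m := by exact_mod_cast hm
  -- With this constant `2 ^ (L / m)` is at least `n ^ (p + 1) / 2`; the extra power of `n` pays for
  -- the `n + 1` positions.
  refine ⟨(p + 1) * m / Real.log 2, 4 * (C * C), ?_⟩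
  intro n hn L hL x β hβ hx
  have hn1 : (1 : ℝ) ≤ n := by exact_mod_cast hn
  have hn0 : (0 : ℝ) < n := by linarith
  have h1 : (n : ℝ) ^ (p + 1) ≤ 2 * 2 ^ (L / m) := by
    have h2 : (p + 1) * m / Real.log 2 * Real.log n ≤ L := by rw [hL]; exact Nat.le_ceil _
    have h3 : (L : ℝ) ≤ m * ((L / m : ℕ) + 1 : ℝ) := by
      exact_mod_cast (Nat.lt_mul_div_succ L hm).le
    have h4 : (p + 1) * Real.log n ≤ Real.log 2 * ((L / m : ℕ) + 1 : ℝ) := by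
      have h5 := h2.trans h3
      rw [div_mul_eq_mul_div, div_le_iff₀ hlog2] at h5
      refine le_of_mul_le_mul_left ?_ hm'
      linarith
    calc (n : ℝ) ^ (p + 1) = Real.exp (Real.log n * (p + 1)) := Real.rpow_def_of_pos hn0 _
      _ ≤ Real.exp (Real.log 2 * ((L / m : ℕ) + 1 : ℝ)) := Real.exp_le_exp.2 (by linarith)
      _ = (2 : ℝ) ^ (((L / m + 1 : ℕ)) : ℝ) := by
          rw [Real.rpow_def_of_pos (by norm_num)]; push_cast; rfl
      _ = 2 * 2 ^ (L / m) := by rw [Real.rpow_natCast, pow_succ]; ring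
  set T : ℝ := 2 ^ (L / m) with hT
  have hT0 : 0 < T := by positivity
  have h6 : (n : ℝ) ≤ (n : ℝ) ^ (-p) * (2 * T) := by
    calc (n : ℝ) = (n : ℝ) ^ (-p) * (n : ℝ) ^ (p + 1) := by
          rw [← Real.rpow_add hn0]; simp
      _ ≤ _ := by gcongr
  refine le_of_mul_le_mul_left ?_ hT0
  calc T * x ≤ (n + 1) * (C * C * β) := hx
    _ ≤ (2 * ((n : ℝ) ^ (-p) * (2 * T))) * (C * C * β) := by gcongr; linarith
    _ = _ := by ring

end Asymptotics

/-! ### Large excursions and the conclusion -/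

section Main

variable {S : Set G}

/-- An element with a large excursion contains a long segment avoiding a suitable element. -/
lemma mem_mul_of_lt_excursion (hS : IsGeodesicMetric (wordDist S)) {H : Set G} {K : ℝ} {b : G}
    {r : ℕ} (hb : ∀ n c, IsGeod (wordDist S) n c → ∀ t : G,
      (∃ h ∈ t • H, wordDist S (c 0) h ≤ ⌈K⌉₊) → (∃ h ∈ t • H, wordDist S (c n) h ≤ ⌈K⌉₊) →
      ∀ x, ∀ i ≤ n, ∀ j ≤ n, ¬ (wordDist S (c i) x ≤ r ∧ wordDist S (c j) (x * b) ≤ r))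
    {n : ℕ} {g : G} (hg : wordDist S 1 g ≤ n) {y : ℝ}
    (hy : ENNReal.ofReal y < excursion S H K g) :
    ∃ i, i + ⌈y⌉₊ ≤ n ∧
      g ∈ bset (wordDist S) i * avoiding (wordDist S) r b ⌈y⌉₊ *
        bset (wordDist S) (n - i - ⌈y⌉₊) := by
  simp only [excursion, geodesicExcursion, diam, lt_iSup_iff] at hy
  obtain ⟨γ, hγ, t, u, hu, v, hv, huv⟩ := hy
  obtain ⟨m, c, hc, h0, hm, rfl⟩ := hγ.exists_isGeod
  have hmn : m ≤ n := by
    have := hc.dist_zero le_rfl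
    rw [h0, hm] at this
    omega
  have hnb : ∀ u ∈ nbhd S K (t • H), ∃ h ∈ t • H, wordDist S u h ≤ ⌈K⌉₊ :=
    fun u hu => exists_of_subset_nbhd (Set.Subset.refl _) hu
  have hL : ⌈y⌉₊ ≤ wordDist S u v := by
    rw [← ENNReal.ofReal_natCast] at huv
    exact Nat.ceil_le.2 (lt_of_not_ge fun h => (ENNReal.ofReal_le_ofReal h).not_gt huv).le
  set L := ⌈y⌉₊
  obtain ⟨⟨i, hi, rfl⟩, hu⟩ := hu
  obtain ⟨⟨j, hj, rfl⟩, hv⟩ := hv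
  simp only [Set.mem_Iic] at hi hj
  -- The initial piece of length `L` of the segment between the two points near the translate of `H`
  -- inherits the avoidance of `b`.
  have key : ∀ i j, i ≤ j → j ≤ m → c i ∈ nbhd S K (t • H) → c j ∈ nbhd S K (t • H) →
      L ≤ wordDist S (c i) (c j) → ∃ i, i + L ≤ n ∧
        g ∈ bset (wordDist S) i * avoiding (wordDist S) r b L * bset (wordDist S) (n - i - L) := by
    intro i j hij hj hu hv hL
    have e1 := hc i j hij hj
    refine ⟨i, by omega, c (i + L), ⟨c i, ?_, (c i)⁻¹ * c (i + L), ?_, by simp⟩,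
      (c (i + L))⁻¹ * g, ?_, by simp⟩
    · have := hc.dist_zero (i := i) (by omega)
      rw [h0] at this
      exact this.le
    · refine ⟨fun k => (c i)⁻¹ * c (i + k), hS.translate (hc.sub i L (by omega)) _, by simp,
        rfl, ?_⟩
      rintro x a ha a' ha' ⟨h1, h2⟩
      have hav := hb (j - i) (fun k => c (i + k)) (hc.sub i (j - i) (by omega)) t
        (by simpa using hnb _ hu) (by simpa [show i + (j - i) = j by omega] using hnb _ hv)
        (c i * x) a (by omega) a' (by omega)
      apply hav
      rw [← hS.left (c i)] at h1 h2
      exact ⟨by simpa using h1, by simpa [mul_assoc] using h2⟩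
    · have := hc (i + L) m (by omega) le_rfl
      rw [hm] at this
      simp only [bset, Set.mem_ofPred_eq, hS.inv_mul]
      omega
  rcases le_total i j with h | h
  · exact key i j h hj hu hv hL
  · exact key j i h hi hv hu (by rwa [hS.comm])

end Main

end CoarseExcursion

open CoarseExcursion

theorem theorem4p2 {G : Type*} [Group G] (S : Set G) (hSfin : S.Finite)
    (hSgen : Subgroup.closure S = ⊤) (hG : ¬ CoarseExcursion.IsVirtuallyCyclic G)
    (H : Set G) (hHconn : CoarseExcursion.IsCoarselyGeodesicallyConnected S H)
    (hHdiam : CoarseExcursion.diam S H = ⊤)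
    (hf : ∃ f : G, CoarseExcursion.IsContractingStronglyIndependent S f H) :
    ∃ K : ℝ, 0 < K ∧ ∀ p : ℝ, 0 < p → ∃ C₁ C₂ : ℝ, 0 < C₁ ∧ ∃ A : ℝ, ∀ n : ℕ, 1 ≤ n →
      1 - A * (n : ℝ) ^ (-p) ≤
        CoarseExcursion.ballProb S n
          {g : G | ENNReal.ofReal (C₁ * Real.log n) ≤ CoarseExcursion.excursion S H K g ∧
            CoarseExcursion.excursion S H K g ≤ ENNReal.ofReal (C₂ * Real.log n)} := by
  have hd := isGeodesicMetric_wordDist hSfin hSgen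
  obtain ⟨f, hf⟩ := hf
  obtain ⟨hinj, E, CH, hE, hH⟩ := hf.exists_contr hd
  obtain ⟨t, ht⟩ := hd.exists_transverse hE hinj hG
  obtain ⟨N, ρ, s, hs⟩ := hd.exists_isExtender hE hinj ht
  obtain ⟨C, -, hC⟩ := hs.ncard_bset_mul_le hd hinj ht
  obtain ⟨X, hX⟩ := hs.ncard_avoiding_le hd
  obtain ⟨R, hR, hconn⟩ := hHconn
  set r := 14 * ρ with hr
  -- This radius depends only on the connectedness constant and the extender, so it is fixed before
  -- `p`.
  refine ⟨R + r, by positivity, fun p hp => ?_⟩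
  obtain ⟨M, hM⟩ := exists_avoiding_of_independent hd hinj hE hH ⌈R + r⌉₊ r
  obtain ⟨m, hm, hexp⟩ := hd.exists_two_pow_mul_ncard_avoiding_le hC (hX (f ^ M))
  obtain ⟨C₁, hC₁, k, A₁, hlow⟩ := exists_lower_rate C X (bset (wordDist S) 1).ncard (2 * r)
    (hd.ncard_bset_pos 1) p
  obtain ⟨C₂, A₂, hup⟩ := exists_upper_rate C m hm p
  refine ⟨C₁, C₂, hC₁, A₁ + A₂, fun n hn => ?_⟩
  set β : ℝ := ((bset (wordDist S) n).ncard : ℝ) with hβ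
  have hβpos : 0 < β := Nat.cast_pos.2 (hd.ncard_bset_pos n)
  -- The summand `2 * r` makes up for the loss at the two ends in `le_excursion`.
  obtain ⟨x₀, b, hbl, hx₀, hx₀b⟩ := exists_segment hd hconn hHdiam (⌈C₁ * Real.log n⌉₊ + 2 * r)
  -- elements with small excursion
  set B₁ := {g ∈ bset (wordDist S) n | g ∈ avoiding (wordDist S) r b (wordDist S 1 g)} with hB₁
  have hcard₁ : (B₁.ncard : ℝ) ≤ A₁ * (n : ℝ) ^ (-p) * β := by
    refine hlow n hn _ rfl _ β hβpos.le ?_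
    have h1 := hd.ncard_ball_avoiding_le hC (hd.succ_le_ncard_bset hinj (n / (2 * k))) (hX b _)
      (k := k) (n := n) (by rw [← mul_assoc]; exact Nat.mul_div_le n (2 * k))
    rw [hbl] at h1
    rw [hβ]
    exact_mod_cast h1
  -- elements with large excursion
  set B₂ := {g ∈ bset (wordDist S) n |
    ENNReal.ofReal (C₂ * Real.log n) < excursion S H (R + r) g} with hB₂
  have hcard₂ : (B₂.ncard : ℝ) ≤ A₂ * (n : ℝ) ^ (-p) * β := by
    refine hup n hn _ rfl _ β hβpos.le ?_
    have h1 := hd.ncard_ball_mul_le hC hexp n ⌈C₂ * Real.log n⌉₊ (B := B₂)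
      fun g hg => mem_mul_of_lt_excursion hd hM hg.1 hg.2
    rw [hβ]
    exact_mod_cast h1
  set good := {g : G | ENNReal.ofReal (C₁ * Real.log n) ≤ excursion S H (R + r) g ∧
    excursion S H (R + r) g ≤ ENNReal.ofReal (C₂ * Real.log n)} with hgood
  have hball : ball S n = bset (wordDist S) n := rfl
  have hsub : bset (wordDist S) n ⊆ (ball S n ∩ good) ∪ (B₁ ∪ B₂) := by
    intro g hg
    by_cases h2 : ENNReal.ofReal (C₂ * Real.log n) < excursion S H (R + r) g
    · exact Or.inr (Or.inr ⟨hg, h2⟩)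
    by_cases h1 : ENNReal.ofReal (C₁ * Real.log n) ≤ excursion S H (R + r) g
    · exact Or.inl ⟨hg, h1, not_lt.1 h2⟩
    · refine Or.inr (Or.inl ⟨hg, mem_avoiding_of_excursion_lt hd hx₀ hx₀b ?_⟩)
      refine (not_le.1 h1).trans_le ?_
      rw [hbl, Nat.add_sub_cancel, ← ENNReal.ofReal_natCast]
      exact ENNReal.ofReal_le_ofReal (Nat.le_ceil _)
  have hcount : β ≤ ((ball S n ∩ good).ncard : ℝ) + (B₁.ncard + B₂.ncard) := by
    have hfin := hd.finite_bset n
    have h1 := Set.ncard_le_ncard hsub ((hfin.subset Set.inter_subset_left).union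
      ((hfin.subset (Set.sep_subset _ _)).union (hfin.subset (Set.sep_subset _ _))))
    have h2 := Set.ncard_union_le (ball S n ∩ good) (B₁ ∪ B₂)
    have h3 := Set.ncard_union_le B₁ B₂
    rw [hβ]
    exact_mod_cast h1.trans (h2.trans (by omega))
  rw [ballProb, hball, ← hβ, le_div_iff₀ hβpos, ← hball]
  linarith
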